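/- Let $n\ge 1$, let $(\widetilde M,J,\widetilde g)$ be a Kähler manifold of real dimension $2n+2$, and let $M$ be a (possibly immersed) real hypersurface of $\widetilde M$ with smooth unit normal field $N$, endowed with the induced metric $g$, its Levi-Civita connection $\nabla$, and the induced almost contact metric structure $(\varphi,\xi,\eta,g)$ given by $\xi=-JN$ and $JX=\varphi X+\eta(X)N$. Put $R(X,Y)Z=\nabla_X\nabla_YZ-\nabla_Y\nabla_XZ-\nabla_{[X,Y]}Z$ and $R(X,Y,Z,W)=g(R(Z,W)Y,X)$, and consider, for all vector fields $X,Y,Z,W$ on $M$, the identities (G1) $R(X,Y,\varphi Z,\varphi W)-R(X,Y,Z,W)=g(Y,\varphi W)g(X,\varphi Z)-g(X,\varphi W)g(Y,\varphi Z)+g(X,W)g(Y,Z)-g(Y,W)g(X,Z)$; (G2) $R(X,Y,Z,W)=R(\varphi X,Y,Z,\varphi W)+R(X,\varphi Y,Z,\varphi W)+R(X,Y,\varphi Z,\varphi W)+g(X,Z)\eta(W)\eta(Y)-g(Z,Y)\eta(X)\eta(W)$; (G3) $R(X,Y,Z,W)=R(\varphi X,\varphi Y,\varphi Z,\varphi W)+g(X,Z)\eta(W)\eta(Y)-g(Z,Y)\eta(X)\eta(W)+g(Y,W)\eta(X)\eta(Z)-g(X,W)\eta(Y)\eta(Z)$.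 An almost contact metric structure is called Sasakian if $d\eta(X,Y)=g(X,\varphi Y)$ and $[\varphi,\varphi]+2\,d\eta\otimes\xi=0$, where $2\,d\eta(X,Y)=X\eta(Y)-Y\eta(X)-\eta([X,Y])$ and $[\varphi,\varphi](X,Y)=\varphi^2[X,Y]+[\varphi X,\varphi Y]-\varphi[\varphi X,Y]-\varphi[X,\varphi Y]$. Suppose that $M$ is totally umbilical, i.e. the Weingarten operator $AX=-\widetilde\nabla_XN$ satisfies $AX=\beta X$ for all $X$ tangent to $M$, with $\beta\in C^\infty(M)$, and that $M$ satisfies (G3). Then $\beta$ takes only the values $1$ and $-1$ and is locally constant (so $\beta\equiv 1$ or $\beta\equiv-1$ on each connected component of $M$), and $M$ is Sasakian after orienting it so that $\beta=-1$: the almost contact metric structure $(\varphi,-\beta\xi,-\beta\eta,g)$ induced by the unit normal $-\beta N$, which is the given structure where $\beta=-1$, is Sasakian. Consequently $M$ satisfies all of (G1), (G2) and (G3). -/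

import Mathlib

open Bundle Manifold VectorField FiberBundle
open scoped ContDiff Topology

noncomputable section

/-! ### The Levi-Civita connection -/

namespace RiemannianGeometry

set_option linter.unusedSectionVars false

/-- The right-hand side of Koszul's formula
`2 g(∇_X Y, Z) = X g(Y, Z) + Y g(Z, X) - Z g(X, Y) + g([X, Y], Z) - g([X, Z], Y) - g([Y, Z], X)`,
at the point `x`. -/
def koszul {E : Type*} [NormedAddCommGroup E] [NormedSpace ℝ E]
    {M : Type*} [TopologicalSpace M] [ChartedSpace E M]
    [RiemannianBundle (fun x : M => TangentSpace 𝓘(ℝ, E) x)]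
    (Y X Z : Π x : M, TangentSpace 𝓘(ℝ, E) x) (x : M) : ℝ :=
  d% (fun y => inner ℝ (Y y) (Z y)) x (X x)
    + d% (fun y => inner ℝ (Z y) (X y)) x (Y x)
    - d% (fun y => inner ℝ (X y) (Y y)) x (Z x)
    + inner ℝ (mlieBracket 𝓘(ℝ, E) X Y x) (Z x)
    - inner ℝ (mlieBracket 𝓘(ℝ, E) X Z x) (Y x)
    - inner ℝ (mlieBracket 𝓘(ℝ, E) Y Z x) (X x)

instance finiteDimensional_tangentSpace {E : Type*} [NormedAddCommGroup E] [NormedSpace ℝ E]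
    [FiniteDimensional ℝ E] {M : Type*} [TopologicalSpace M] [ChartedSpace E M] (x : M) :
    FiniteDimensional ℝ (TangentSpace 𝓘(ℝ, E) x) :=
  inferInstanceAs (FiniteDimensional ℝ E)

instance completeSpace_tangentSpace {E : Type*} [NormedAddCommGroup E] [NormedSpace ℝ E]
    [FiniteDimensional ℝ E] {M : Type*} [TopologicalSpace M] [ChartedSpace E M]
    [RiemannianBundle (fun x : M => TangentSpace 𝓘(ℝ, E) x)] (x : M) :
    CompleteSpace (TangentSpace 𝓘(ℝ, E) x) :=
  FiniteDimensional.complete ℝ _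

variable {E : Type*} [NormedAddCommGroup E] [NormedSpace ℝ E] [FiniteDimensional ℝ E]
  {M : Type*} [TopologicalSpace M] [ChartedSpace E M] [IsManifold 𝓘(ℝ, E) ∞ M]
  [RiemannianBundle (fun x : M => TangentSpace 𝓘(ℝ, E) x)]
  [IsContMDiffRiemannianBundle 𝓘(ℝ, E) ∞ E (fun x : M => TangentSpace 𝓘(ℝ, E) x)]

theorem mdifferentiableAt_inner {Y Z : Π x : M, TangentSpace 𝓘(ℝ, E) x} {x : M}
    (hY : MDiffAt (T% Y) x) (hZ : MDiffAt (T% Z) x) :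
    MDiffAt (fun y => (inner ℝ (Y y) (Z y) : ℝ)) x :=
  MDifferentiableAt.inner_bundle (F := E) (E := fun x : M => TangentSpace 𝓘(ℝ, E) x) hY hZ

theorem tensorialAt_koszul_left {Y Z : Π x : M, TangentSpace 𝓘(ℝ, E) x} {x : M}
    (hY : MDiffAt (T% Y) x) (hZ : MDiffAt (T% Z) x) :
    TensorialAt 𝓘(ℝ, E) E (fun X => koszul Y X Z x) x where
  smul {f X} hf hX := by
    have h1 := mvfderiv_fun_mul hf (mdifferentiableAt_inner hZ hX)
    have h2 := mvfderiv_fun_mul hf (mdifferentiableAt_inner hX hY)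
    simp [koszul, inner_smul_left, inner_smul_right, h1, h2,
      mlieBracket_smul_left hf hX, inner_add_left]
    rw [real_inner_comm (X x) (Z x)]
    ring
  add {X X'} hX hX' := by
    have h1 := mvfderiv_fun_add (mdifferentiableAt_inner hZ hX) (mdifferentiableAt_inner hZ hX')
    have h2 := mvfderiv_fun_add (mdifferentiableAt_inner hX hY) (mdifferentiableAt_inner hX' hY)
    simp [koszul, inner_add_left, inner_add_right, h1, h2, mlieBracket_add_left hX hX']
    ring

theorem tensorialAt_koszul_right {Y X : Π x : M, TangentSpace 𝓘(ℝ, E) x} {x : M}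
    (hY : MDiffAt (T% Y) x) (hX : MDiffAt (T% X) x) :
    TensorialAt 𝓘(ℝ, E) E (fun Z => koszul Y X Z x) x where
  smul {f Z} hf hZ := by
    have h1 := mvfderiv_fun_mul hf (mdifferentiableAt_inner hY hZ)
    have h2 := mvfderiv_fun_mul hf (mdifferentiableAt_inner hZ hX)
    simp [koszul, inner_smul_left, inner_smul_right, h1, h2,
      mlieBracket_smul_right hf hZ, inner_add_left]
    rw [real_inner_comm (Y x) (Z x), real_inner_comm (X x) (Z x)]
    ring
  add {Z Z'} hZ hZ' := by
    have h1 := mvfderiv_fun_add (mdifferentiableAt_inner hY hZ) (mdifferentiableAt_inner hY hZ')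
    have h2 := mvfderiv_fun_add (mdifferentiableAt_inner hZ hX) (mdifferentiableAt_inner hZ' hX)
    simp [koszul, inner_add_left, inner_add_right, h1, h2, mlieBracket_add_right hZ hZ']
    ring

open scoped Classical in
/-- Koszul's expression at `x`, as a bilinear form in the values of `X` and `Z` at `x`
(zero if `Y` is not differentiable at `x`). -/
def koszulForm (Y : Π x : M, TangentSpace 𝓘(ℝ, E) x) (x : M) :
    TangentSpace 𝓘(ℝ, E) x →L[ℝ] TangentSpace 𝓘(ℝ, E) x →L[ℝ] ℝ :=
  if hY : MDiffAt (T% Y) x then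
    TensorialAt.mkHom₂ (F := E) (F' := E) (I := 𝓘(ℝ, E)) (fun X Z => koszul Y X Z x) x
      (fun _ hZ => tensorialAt_koszul_left hY hZ) (fun _ hX => tensorialAt_koszul_right hY hX)
  else 0

theorem koszulForm_apply {Y X Z : Π x : M, TangentSpace 𝓘(ℝ, E) x} {x : M}
    (hY : MDiffAt (T% Y) x) (hX : MDiffAt (T% X) x) (hZ : MDiffAt (T% Z) x) :
    koszulForm Y x (X x) (Z x) = koszul Y X Z x := by
  rw [koszulForm, dif_pos hY]
  exact TensorialAt.mkHom₂_apply (F := E) (F' := E) (I := 𝓘(ℝ, E))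
    (Φ := fun X Z => koszul Y X Z x) _ _ hX hZ

/-- The covariant derivative `v ↦ ∇_v Y` at `x`, determined by Koszul's formula. -/
def leviCivitaAux (Y : Π x : M, TangentSpace 𝓘(ℝ, E) x) (x : M) :
    TangentSpace 𝓘(ℝ, E) x →L[ℝ] TangentSpace 𝓘(ℝ, E) x :=
  (1 / 2 : ℝ) • ((InnerProductSpace.toDual ℝ
    (TangentSpace 𝓘(ℝ, E) x)).symm.toContinuousLinearEquiv.toContinuousLinearMap ∘L koszulForm Y x)

theorem inner_leviCivitaAux {Y X Z : Π x : M, TangentSpace 𝓘(ℝ, E) x} {x : M}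
    (hY : MDiffAt (T% Y) x) (hX : MDiffAt (T% X) x) (hZ : MDiffAt (T% Z) x) :
    (inner ℝ (leviCivitaAux Y x (X x)) (Z x) : ℝ) = 1 / 2 * koszul Y X Z x := by
  simp [leviCivitaAux, inner_smul_left, koszulForm_apply hY hX hZ]

/-- Two endomorphisms of a tangent space agree if their matrix coefficients agree on values of
differentiable vector fields. -/
theorem endo_ext {x : M} {A B : TangentSpace 𝓘(ℝ, E) x →L[ℝ] TangentSpace 𝓘(ℝ, E) x}
    (h : ∀ X Z : Π y : M, TangentSpace 𝓘(ℝ, E) y, MDiffAt (T% X) x → MDiffAt (T% Z) x →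
      (inner ℝ (A (X x)) (Z x) : ℝ) = inner ℝ (B (X x)) (Z x)) : A = B := by
  ext v
  refine ext_inner_right ℝ fun w => ?_
  have := h (extend E v) (extend E w) (mdifferentiableAt_extend ..) (mdifferentiableAt_extend ..)
  simpa using this

variable (E M) in
/-- The Levi-Civita connection of a Riemannian manifold; `leviCivita E M Y x v` is `(∇_v Y)(x)`. -/
def leviCivita : CovariantDerivative 𝓘(ℝ, E) E (fun x : M => TangentSpace 𝓘(ℝ, E) x) where
  toFun := leviCivitaAux
  isCovariantDerivativeOnUniv :=
    { add := by
        intro Y Y' x hY hY' _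
        refine endo_ext fun X Z hX hZ => ?_
        rw [inner_leviCivitaAux (mdifferentiableAt_add_section hY hY') hX hZ,
          add_apply, inner_add_left,
          inner_leviCivitaAux hY hX hZ, inner_leviCivitaAux hY' hX hZ]
        have h1 := mvfderiv_fun_add (mdifferentiableAt_inner hY hZ) (mdifferentiableAt_inner hY' hZ)
        have h2 := mvfderiv_fun_add (mdifferentiableAt_inner hX hY) (mdifferentiableAt_inner hX hY')
        simp [koszul, inner_add_left, inner_add_right, h1, h2, mlieBracket_add_left hY hY',
          mlieBracket_add_right hY hY']
        ring
      leibniz := by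
        intro Y f x hY hf _
        refine endo_ext fun X Z hX hZ => ?_
        rw [inner_leviCivitaAux (hf.smul_section hY) hX hZ,
          add_apply, inner_add_left, smul_apply,
          inner_smul_left, inner_leviCivitaAux hY hX hZ]
        have h1 := mvfderiv_fun_mul hf (mdifferentiableAt_inner hY hZ)
        have h2 := mvfderiv_fun_mul hf (mdifferentiableAt_inner hX hY)
        simp [koszul, inner_add_left, inner_smul_left, inner_smul_right, h1, h2,
          mlieBracket_smul_left hf hY, mlieBracket_smul_right hf hY]
        rw [real_inner_comm (Y x) (X x)]
        ring }

theorem inner_swap (X Y : Π y : M, TangentSpace 𝓘(ℝ, E) y) :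
    (fun y => (inner ℝ (X y) (Y y) : ℝ)) = fun y => inner ℝ (Y y) (X y) :=
  funext fun _ => real_inner_comm _ _

theorem leviCivita_torsion : (leviCivita E M).torsion = 0 := by
  rw [CovariantDerivative.torsion_eq_zero_iff]
  intro X Y x hX hY
  refine ext_inner_right ℝ fun w => ?_
  obtain ⟨Z, hZ, rfl⟩ : ∃ Z : Π y : M, TangentSpace 𝓘(ℝ, E) y, MDiffAt (T% Z) x ∧ Z x = w :=
    ⟨extend E w, mdifferentiableAt_extend .., by simp⟩
  change inner ℝ (leviCivitaAux Y x (X x) - leviCivitaAux X x (Y x)) (Z x) = _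
  rw [inner_sub_left, inner_leviCivitaAux hY hX hZ, inner_leviCivitaAux hX hY hZ]
  simp only [koszul, mlieBracket_swap_apply (V := Y) (W := X), inner_neg_left,
    inner_swap Y X, inner_swap Z X, inner_swap Z Y]
  ring

theorem leviCivita_inner {x : M} {X Y Z : Π y : M, TangentSpace 𝓘(ℝ, E) y}
    (hX : MDiffAt (T% X) x) (hY : MDiffAt (T% Y) x) (hZ : MDiffAt (T% Z) x) :
    d% (fun y => (inner ℝ (Y y) (Z y) : ℝ)) x (X x) =
      inner ℝ (leviCivita E M Y x (X x)) (Z x) + inner ℝ (Y x) (leviCivita E M Z x (X x)) := by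
  change _ = inner ℝ (leviCivitaAux Y x (X x)) (Z x) + inner ℝ (Y x) (leviCivitaAux Z x (X x))
  rw [real_inner_comm _ (Y x), inner_leviCivitaAux hY hX hZ, inner_leviCivitaAux hZ hX hY]
  simp only [koszul, mlieBracket_swap_apply (V := Z) (W := Y), inner_neg_left,
    inner_swap Y X, inner_swap Z X, inner_swap Z Y]
  ring

theorem leviCivita_isMetricCompatible :
    CovariantDerivative.IsMetricCompatible (V := fun x : M => TangentSpace 𝓘(ℝ, E) x)
      (leviCivita E M) := by
  rw [CovariantDerivative.isMetricCompatible_iff]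
  exact fun hX hY hZ => leviCivita_inner hX hY hZ

/-- The curvature `R(X, Y)Z = ∇_X ∇_Y Z - ∇_Y ∇_X Z - ∇_{[X, Y]} Z` at the point `x`. -/
def curvature (X Y Z : Π x : M, TangentSpace 𝓘(ℝ, E) x) (x : M) : TangentSpace 𝓘(ℝ, E) x :=
  leviCivita E M (fun y => leviCivita E M Z y (Y y)) x (X x)
    - leviCivita E M (fun y => leviCivita E M Z y (X y)) x (Y x)
    - leviCivita E M Z x (mlieBracket 𝓘(ℝ, E) X Y x)

/-- The curvature tensor of type `(0, 4)`, `R(X, Y, Z, W) = g(R(Z, W)Y, X)`; with this sign the unit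
sphere has `R(X, Y, Z, W) = g(X, Z) g(Y, W) - g(X, W) g(Y, Z)`. -/
def riemann (X Y Z W : Π x : M, TangentSpace 𝓘(ℝ, E) x) (x : M) : ℝ :=
  inner ℝ (curvature Z W Y x) (X x)

/-- A Kähler structure: a smooth orthogonal almost complex structure `J` that is parallel for the
Levi-Civita connection. -/
structure IsKaehler (J : Π x : M, TangentSpace 𝓘(ℝ, E) x →L[ℝ] TangentSpace 𝓘(ℝ, E) x) :
    Prop where
  smooth : ContMDiff 𝓘(ℝ, E) (𝓘(ℝ, E).prod 𝓘(ℝ, E →L[ℝ] E)) ∞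
    (fun x => TotalSpace.mk' (E →L[ℝ] E)
      (E := fun x : M => TangentSpace 𝓘(ℝ, E) x →L[ℝ] TangentSpace 𝓘(ℝ, E) x) x (J x))
  sq : ∀ x v, J x (J x v) = -v
  inner_map_map : ∀ x u v, (inner ℝ (J x u) (J x v) : ℝ) = inner ℝ u v
  parallel : ∀ x (Y : Π y : M, TangentSpace 𝓘(ℝ, E) y), MDiffAt (T% Y) x →
    ∀ v, leviCivita E M (fun y => J y (Y y)) x v = J x (leviCivita E M Y x v)

/-! ### Almost contact metric structures -/

variable (E M) in
/-- The tensor fields `(φ, ξ, η)` of an almost contact structure; the axioms relating them to each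
other and to the metric are in `AlmostContact.IsMetric`. -/
structure AlmostContact where
  φ : Π x : M, TangentSpace 𝓘(ℝ, E) x →L[ℝ] TangentSpace 𝓘(ℝ, E) x
  ξ : Π x : M, TangentSpace 𝓘(ℝ, E) x
  η : Π x : M, TangentSpace 𝓘(ℝ, E) x →L[ℝ] ℝ

namespace AlmostContact

variable (S : AlmostContact E M)

/-- `(φ, ξ, η, g)` is an almost contact metric structure. -/
structure IsMetric : Prop where
  smooth_φ : ContMDiff 𝓘(ℝ, E) (𝓘(ℝ, E).prod 𝓘(ℝ, E →L[ℝ] E)) ∞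
    (fun x => TotalSpace.mk' (E →L[ℝ] E)
      (E := fun x : M => TangentSpace 𝓘(ℝ, E) x →L[ℝ] TangentSpace 𝓘(ℝ, E) x) x (S.φ x))
  smooth_ξ : ContMDiff 𝓘(ℝ, E) 𝓘(ℝ, E).tangent ∞ (fun x => (⟨x, S.ξ x⟩ : TangentBundle 𝓘(ℝ, E) M))
  smooth_η : ContMDiff 𝓘(ℝ, E) (𝓘(ℝ, E).prod 𝓘(ℝ, E →L[ℝ] ℝ)) ∞
    (fun x => TotalSpace.mk' (E →L[ℝ] ℝ)
      (E := fun x : M => TangentSpace 𝓘(ℝ, E) x →L[ℝ] ℝ) x (S.η x))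
  φ_sq : ∀ x v, S.φ x (S.φ x v) = -v + S.η x v • S.ξ x
  η_ξ : ∀ x, S.η x (S.ξ x) = 1
  inner_φ_φ : ∀ x u v, (inner ℝ (S.φ x u) (S.φ x v) : ℝ) = inner ℝ u v - S.η x u * S.η x v

/-- `dη(X, Y) = (X η(Y) - Y η(X) - η([X, Y])) / 2` at the point `x`. -/
def dη (X Y : Π x : M, TangentSpace 𝓘(ℝ, E) x) (x : M) : ℝ :=
  1 / 2 * (d% (fun y => S.η y (Y y)) x (X x) - d% (fun y => S.η y (X y)) x (Y x)
    - S.η x (mlieBracket 𝓘(ℝ, E) X Y x))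

/-- The Nijenhuis torsion
`[φ, φ](X, Y) = φ² [X, Y] + [φ X, φ Y] - φ [φ X, Y] - φ [X, φ Y]` at the point `x`. -/
def nijenhuis (X Y : Π x : M, TangentSpace 𝓘(ℝ, E) x) (x : M) : TangentSpace 𝓘(ℝ, E) x :=
  S.φ x (S.φ x (mlieBracket 𝓘(ℝ, E) X Y x))
    + mlieBracket 𝓘(ℝ, E) (fun y => S.φ y (X y)) (fun y => S.φ y (Y y)) x
    - S.φ x (mlieBracket 𝓘(ℝ, E) (fun y => S.φ y (X y)) Y x)
    - S.φ x (mlieBracket 𝓘(ℝ, E) X (fun y => S.φ y (Y y)) x)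

end AlmostContact

/-- The vector field `X` is smooth near `x`. -/
def SmoothAt (X : Π x : M, TangentSpace 𝓘(ℝ, E) x) (x : M) : Prop :=
  ∀ᶠ y in 𝓝 x, ContMDiffAt 𝓘(ℝ, E) 𝓘(ℝ, E).tangent ∞
    (fun z => (⟨z, X z⟩ : TangentBundle 𝓘(ℝ, E) M)) y

namespace AlmostContact

variable (S : AlmostContact E M)

/-- A Sasakian structure: an almost contact metric structure that is a contact metric structure,
`dη(X, Y) = g(X, φ Y)`, and normal, `[φ, φ] + 2 dη ⊗ ξ = 0`. -/
structure IsSasakian : Prop extends S.IsMetric where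
  contact : ∀ x (X Y : Π y : M, TangentSpace 𝓘(ℝ, E) y), SmoothAt X x → SmoothAt Y x →
    S.dη X Y x = inner ℝ (X x) (S.φ x (Y x))
  normal : ∀ x (X Y : Π y : M, TangentSpace 𝓘(ℝ, E) y), SmoothAt X x → SmoothAt Y x →
    S.nijenhuis X Y x + (2 * S.dη X Y x) • S.ξ x = 0

/-- The vector field `φ X`. -/
def φField (X : Π x : M, TangentSpace 𝓘(ℝ, E) x) : Π x : M, TangentSpace 𝓘(ℝ, E) x :=
  fun x => S.φ x (X x)

/-- The identity (G1). -/
def G1 : Prop :=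
  ∀ x (X Y Z W : Π y : M, TangentSpace 𝓘(ℝ, E) y),
    SmoothAt X x → SmoothAt Y x → SmoothAt Z x → SmoothAt W x →
    riemann X Y (S.φField Z) (S.φField W) x - riemann X Y Z W x =
      inner ℝ (Y x) (S.φ x (W x)) * inner ℝ (X x) (S.φ x (Z x))
        - inner ℝ (X x) (S.φ x (W x)) * inner ℝ (Y x) (S.φ x (Z x))
        + inner ℝ (X x) (W x) * inner ℝ (Y x) (Z x)
        - inner ℝ (Y x) (W x) * inner ℝ (X x) (Z x)

/-- The identity (G2). -/
def G2 : Prop :=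
  ∀ x (X Y Z W : Π y : M, TangentSpace 𝓘(ℝ, E) y),
    SmoothAt X x → SmoothAt Y x → SmoothAt Z x → SmoothAt W x →
    riemann X Y Z W x =
      riemann (S.φField X) Y Z (S.φField W) x + riemann X (S.φField Y) Z (S.φField W) x
        + riemann X Y (S.φField Z) (S.φField W) x
        + inner ℝ (X x) (Z x) * S.η x (W x) * S.η x (Y x)
        - inner ℝ (Z x) (Y x) * S.η x (X x) * S.η x (W x)

/-- The identity (G3). -/
def G3 : Prop :=
  ∀ x (X Y Z W : Π y : M, TangentSpace 𝓘(ℝ, E) y),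
    SmoothAt X x → SmoothAt Y x → SmoothAt Z x → SmoothAt W x →
    riemann X Y Z W x =
      riemann (S.φField X) (S.φField Y) (S.φField Z) (S.φField W) x
        + inner ℝ (X x) (Z x) * S.η x (W x) * S.η x (Y x)
        - inner ℝ (Z x) (Y x) * S.η x (X x) * S.η x (W x)
        + inner ℝ (Y x) (W x) * S.η x (X x) * S.η x (Z x)
        - inner ℝ (X x) (W x) * S.η x (Y x) * S.η x (Z x)

end AlmostContact

/-! ### Hypersurfaces -/

variable {E' : Type*} [NormedAddCommGroup E'] [NormedSpace ℝ E'] [FiniteDimensional ℝ E']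
  {M' : Type*} [TopologicalSpace M'] [ChartedSpace E' M'] [IsManifold 𝓘(ℝ, E') ∞ M']
  [RiemannianBundle (fun x : M' => TangentSpace 𝓘(ℝ, E') x)]
  [IsContMDiffRiemannianBundle 𝓘(ℝ, E') ∞ E' (fun x : M' => TangentSpace 𝓘(ℝ, E') x)]

variable (E) in
/-- The covariant derivative `v ↦ ∇'_v s` at `x` of a vector field `s` along `f : M → M'`, with
respect to the Levi-Civita connection `∇'` of `M'` (pulled back by `f`). In a local frame `e_i` of
`M'` near `f x`, with `s = ∑ s^i e_i`, this is `∑ ds^i(v) e_i + ∑ s^i(x) ∇'_{df(v)} e_i`; the frame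
used is the one of the preferred trivialization of the tangent bundle at `f x`, in which
`extend E' (s x)` is the local vector field `∑ s^i(x) e_i`. -/
def covAlong (f : M → M') (s : Π x : M, TangentSpace 𝓘(ℝ, E') (f x)) (x : M) :
    TangentSpace 𝓘(ℝ, E) x →L[ℝ] TangentSpace 𝓘(ℝ, E') (f x) :=
  (trivializationAt E' (fun p : M' => TangentSpace 𝓘(ℝ, E') p) (f x)).symmL ℝ (f x) ∘L
      (d% (fun y => (trivializationAt E' (fun p : M' => TangentSpace 𝓘(ℝ, E') p) (f x)
        ⟨f y, s y⟩).2) x)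
    + leviCivita E' M' (extend E' (s x)) (f x) ∘L mfderiv 𝓘(ℝ, E) 𝓘(ℝ, E') f x

/-- Along `f`, the restriction of a vector field `Y` of `M'` has covariant derivative
`∇'_{df(v)} Y`. -/
theorem covAlong_comp {f : M → M'} {x : M} (hf : MDifferentiableAt 𝓘(ℝ, E) 𝓘(ℝ, E') f x)
    {Y : Π p : M', TangentSpace 𝓘(ℝ, E') p} (hY : MDiffAt (T% Y) (f x))
    (v : TangentSpace 𝓘(ℝ, E) x) :
    covAlong E f (fun y => Y (f y)) x v =
      leviCivita E' M' Y (f x) (mfderiv 𝓘(ℝ, E) 𝓘(ℝ, E') f x v) := by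
  set p := f x with hp
  set t := trivializationAt E' (fun p : M' => TangentSpace 𝓘(ℝ, E') p) p with ht
  have hd : ∀ {σ : Π p : M', TangentSpace 𝓘(ℝ, E') p}, MDiffAt (T% σ) p →
        MDiffAt (fun q => (t ⟨q, σ q⟩).2) p := fun h =>
      ((mdifferentiableAt_section _ _).1 h)
  have hev : ∀ᶠ q in 𝓝 p, q ∈ t.baseSet :=
      t.open_baseSet.mem_nhds (mem_baseSet_trivializationAt' p)
  have key : TensorialAt 𝓘(ℝ, E') E' (fun Y : Π p : M', TangentSpace 𝓘(ℝ, E') p =>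
      leviCivita E' M' Y p - t.symmL ℝ p ∘L (d% (fun q => (t ⟨q, Y q⟩).2) p)) p := by
    constructor
    · intro g σ hg hσ
      have h1 : d% (fun q => (t ⟨q, (g • σ) q⟩).2) p = d% (fun q => g q • (t ⟨q, σ q⟩).2) p := by
        unfold mvfderiv
        congr 1
        apply Filter.EventuallyEq.mfderiv_eq
        filter_upwards [hev] with q hq
        exact (t.linear ℝ hq).map_smul _ _
      rw [h1, (leviCivita E' M').isCovariantDerivativeOnUniv.leibniz hσ hg, mvfderiv_fun_smul hg (hd hσ)]
      have h3 : t.symmL ℝ p (t ⟨p, σ p⟩).2 = σ p := by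
        rw [Trivialization.symmL_apply _ (mem_baseSet_trivializationAt' p)]
        exact t.symm_apply_apply_mk (mem_baseSet_trivializationAt' p) (σ p)
      ext w
      simp [h3, smul_sub]
    · intro σ σ' hσ hσ'
      have h1 : d% (fun q => (t ⟨q, (σ + σ') q⟩).2) p
          = d% (fun q => (t ⟨q, σ q⟩).2 + (t ⟨q, σ' q⟩).2) p := by
        unfold mvfderiv
        congr 1
        apply Filter.EventuallyEq.mfderiv_eq
        filter_upwards [hev] with q hq
        exact (t.linear ℝ hq).map_add _ _
      rw [h1, (leviCivita E' M').isCovariantDerivativeOnUniv.add hσ hσ', mvfderiv_fun_add (hd hσ) (hd hσ')]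
      ext w
      simp
      abel
  have h2 := key.pointwise hY (mdifferentiableAt_extend 𝓘(ℝ, E') E' (Y p)) (by simp)
  have h4 : d% (fun q => (t ⟨q, extend E' (Y p) q⟩).2) p = 0 := by
    rw [← mvfderiv_const (I := 𝓘(ℝ, E')) (x := p) (t ⟨p, Y p⟩).2]
    unfold mvfderiv
    congr 1
    apply Filter.EventuallyEq.mfderiv_eq
    filter_upwards [hev] with q hq
    have h7 := congrArg Prod.snd (t.apply_mk_symm hq (t ⟨p, Y p⟩).2)
    exact h7
  rw [h4] at h2
  have h5 : d% (fun y => (t ⟨f y, Y (f y)⟩).2) x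
      = d% (fun q => (t ⟨q, Y q⟩).2) p ∘L mfderiv 𝓘(ℝ, E) 𝓘(ℝ, E') f x := by
    unfold mvfderiv
    have := mfderiv_comp x (hd hY) hf
    ext w
    exact congr($this w)
  change t.symmL ℝ p (d% (fun y => (t ⟨f y, Y (f y)⟩).2) x v)
    + leviCivita E' M' (extend E' (Y p)) p (mfderiv 𝓘(ℝ, E) 𝓘(ℝ, E') f x v)
    = leviCivita E' M' Y p (mfderiv 𝓘(ℝ, E) 𝓘(ℝ, E') f x v)
  rw [h5]
  have h6 := congr($h2 (mfderiv 𝓘(ℝ, E) 𝓘(ℝ, E') f x v))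
  simp at h6 ⊢
  rw [← h6]
  abel

variable (E) in
/-- `f : M → M'` is an isometric immersion (so that `M` carries the induced metric), with smooth
unit normal field `N`. -/
structure IsUnitNormal (f : M → M') (N : Π x : M, TangentSpace 𝓘(ℝ, E') (f x)) : Prop where
  smooth : ContMDiff 𝓘(ℝ, E) 𝓘(ℝ, E') ∞ f
  isometry : ∀ x u v, (inner ℝ (mfderiv 𝓘(ℝ, E) 𝓘(ℝ, E') f x u)
    (mfderiv 𝓘(ℝ, E) 𝓘(ℝ, E') f x v) : ℝ) = inner ℝ u v
  smooth_normal : ContMDiff 𝓘(ℝ, E) 𝓘(ℝ, E').tangent ∞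
    (fun x => (⟨f x, N x⟩ : TangentBundle 𝓘(ℝ, E') M'))
  unit : ∀ x, ‖N x‖ = 1
  normal : ∀ x u, (inner ℝ (N x) (mfderiv 𝓘(ℝ, E) 𝓘(ℝ, E') f x u) : ℝ) = 0

variable (E) in
/-- The tangential part of vectors of `M'` at points of `M`: for an isometric immersion `f`, the
adjoint of `df` is the orthogonal projection onto the image of `df`, followed by the inverse
of `df`. -/
def tangential (f : M → M') (x : M) :
    TangentSpace 𝓘(ℝ, E') (f x) →L[ℝ] TangentSpace 𝓘(ℝ, E) x :=
  ContinuousLinearMap.adjoint (mfderiv 𝓘(ℝ, E) 𝓘(ℝ, E') f x)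

variable (E) in
/-- The Weingarten operator, `A v = - ∇'_v N`. -/
def weingarten (f : M → M') (N : Π x : M, TangentSpace 𝓘(ℝ, E') (f x)) (x : M) :
    TangentSpace 𝓘(ℝ, E) x →L[ℝ] TangentSpace 𝓘(ℝ, E) x :=
  -(tangential E f x ∘L covAlong E f N x)

variable (E) in
/-- The hypersurface is totally umbilical with umbilicity factor `β`: `A = β I`. -/
def IsTotallyUmbilical (f : M → M') (N : Π x : M, TangentSpace 𝓘(ℝ, E') (f x)) (β : M → ℝ) :
    Prop :=
  ContMDiff 𝓘(ℝ, E) 𝓘(ℝ) ∞ β ∧ ∀ x v, weingarten E f N x v = β x • v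

variable (E) in
/-- The almost contact structure induced on a hypersurface with unit normal `N` by `J`:
`ξ = -J N` and `J X = φ X + η(X) N`. -/
def inducedAlmostContact
    (J : Π x : M', TangentSpace 𝓘(ℝ, E') x →L[ℝ] TangentSpace 𝓘(ℝ, E') x)
    (f : M → M') (N : Π x : M, TangentSpace 𝓘(ℝ, E') (f x)) : AlmostContact E M where
  φ x := tangential E f x ∘L J (f x) ∘L mfderiv 𝓘(ℝ, E) 𝓘(ℝ, E') f x
  ξ x := tangential E f x (-J (f x) (N x))
  η x := innerSL ℝ (N x) ∘L J (f x) ∘L mfderiv 𝓘(ℝ, E) 𝓘(ℝ, E') f x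

/-- On a hypersurface, `inducedAlmostContact` is characterized by `ξ = -J N` and
`J X = φ X + η(X) N`. -/
theorem inducedAlmostContact_decomposition
    {J : Π x : M', TangentSpace 𝓘(ℝ, E') x →L[ℝ] TangentSpace 𝓘(ℝ, E') x} (hJ : IsKaehler J)
    {f : M → M'} {N : Π x : M, TangentSpace 𝓘(ℝ, E') (f x)} (hN : IsUnitNormal E f N)
    (hdim : Module.finrank ℝ E' = Module.finrank ℝ E + 1) (x : M) :
    mfderiv 𝓘(ℝ, E) 𝓘(ℝ, E') f x ((inducedAlmostContact E J f N).ξ x) = -J (f x) (N x) ∧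
    ∀ v, J (f x) (mfderiv 𝓘(ℝ, E) 𝓘(ℝ, E') f x v) =
      mfderiv 𝓘(ℝ, E) 𝓘(ℝ, E') f x ((inducedAlmostContact E J f N).φ x v)
        + (inducedAlmostContact E J f N).η x v • N x := by
  set L := mfderiv 𝓘(ℝ, E) 𝓘(ℝ, E') f x with hL
  have hadj : ∀ u, tangential E f x (L u) = u := fun u => by
    refine ext_inner_right ℝ fun w => ?_
    rw [tangential, ContinuousLinearMap.adjoint_inner_left]
    exact hN.isometry x u w
  have hinj : Function.Injective L := fun u v h => by
    rw [← hadj u, ← hadj v, h]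
  have hN0 : N x ≠ 0 := fun h => by simpa [h] using hN.unit x
  have hNN : (inner ℝ (N x) (N x) : ℝ) = 1 := by
    rw [real_inner_self_eq_norm_sq, hN.unit x]; norm_num
  have hrange : LinearMap.range (L : TangentSpace 𝓘(ℝ, E) x →ₗ[ℝ] TangentSpace 𝓘(ℝ, E') (f x))
      = (ℝ ∙ N x)ᗮ := by
    apply Submodule.eq_of_le_of_finrank_eq
    · rintro _ ⟨u, rfl⟩
      rw [Submodule.mem_orthogonal_singleton_iff_inner_right]
      exact hN.normal x u
    · rw [LinearMap.finrank_range_of_inj hinj]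
      have h1 := Submodule.finrank_add_finrank_orthogonal (ℝ ∙ N x)
      rw [finrank_span_singleton hN0] at h1
      have h2 : Module.finrank ℝ (TangentSpace 𝓘(ℝ, E') (f x)) = Module.finrank ℝ E' := rfl
      have h3 : Module.finrank ℝ (TangentSpace 𝓘(ℝ, E) x) = Module.finrank ℝ E := rfl
      omega
  have hproj : ∀ w : TangentSpace 𝓘(ℝ, E') (f x), (inner ℝ (N x) w : ℝ) = 0 →
      L (tangential E f x w) = w := fun w hw => by
    rw [← Submodule.mem_orthogonal_singleton_iff_inner_right, ← hrange] at hw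
    obtain ⟨u, rfl⟩ := hw
    exact congrArg L (hadj u)
  have hskew : ∀ u v : TangentSpace 𝓘(ℝ, E') (f x),
      (inner ℝ u (J (f x) v) : ℝ) = - inner ℝ (J (f x) u) v := fun u v => by
    rw [← hJ.inner_map_map (f x) u (J (f x) v), hJ.sq, inner_neg_right]
  have hNJ : (inner ℝ (N x) (J (f x) (N x)) : ℝ) = 0 := by
    have := hskew (N x) (N x)
    rw [real_inner_comm] at this
    rw [real_inner_comm]
    linarith
  constructor
  · exact hproj _ (by rw [inner_neg_right, hNJ, neg_zero])
  · intro v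
    have h1 := hproj (J (f x) (L v) - (inner ℝ (N x) (J (f x) (L v)) : ℝ) • N x)
      (by rw [inner_sub_right, inner_smul_right, hNN]; ring)
    have h2 : tangential E f x (N x) = 0 := by
      refine ext_inner_right ℝ fun w => ?_
      rw [tangential, ContinuousLinearMap.adjoint_inner_left, inner_zero_left]
      exact hN.normal x w
    rw [map_sub, map_smul, h2, smul_zero, sub_zero] at h1
    change J (f x) (L v) = L (tangential E f x (J (f x) (L v)))
      + (inner ℝ (N x) (J (f x) (L v)) : ℝ) • N x
    rw [h1]
    abel
end RiemannianGeometry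
end

/-! On a totally umbilical hypersurface `A = βI`, so the ambient derivative of `N` along `v` is `-β
df(v)`. Differentiating `ξ = -JN` and `JX = φX + η(X)N` with `J` parallel, and taking tangential
parts, gives `∇_v ξ = βφv` and `(∇_v φ)Y = -β(g(v,Y)ξ - η(Y)v)`. With `α = -β` this is the notion
`IsAlphaSasakian`, established in `inducedAlmostContact_isAlphaSasakian`; from there on the argument
is intrinsic to `M`.

Commuting derivatives of `ξ` gives `R(X,Y)ξ = dα(Y)φX - dα(X)φY + α²(η(Y)X - η(X)Y)`
(`curvature_ξ`). For `v` orthogonal to `ξ`, insert `(v, ξ, v, ξ)` in (G3). The curvature term on the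
right dies because `φξ = 0`, the `dα` terms die because `φ` is skew and `φξ = 0`, and what is left
is `α²|v|² = |v|²`. Hence `β² = 1`, and continuity makes `β` locally constant (`sq_eq_one`,
`isLocallyConstant_of_sq_eq_one`).

The smooth sign `-β` may now multiply the normal. The new umbilicity factor is `-β² = -1`, so the
new structure has `α = 1`. The Sasakian equations follow by writing Lie brackets through `∇`
(`isSasakian`). The commutator of `R(X,Y)` with `φ` is then algebraic (`curvature_φ`); pair symmetry
of the curvature turns it into (G1), and (G1) with the commutator once more gives (G2). Both return
to the original normal because `φ` does not see `N` and `η` enters (G2) only in products of two.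

The supporting calculus is the commutator formula for derivatives, the symmetries of the curvature,
and the fact that the connection along `f` is metric, torsion free and compatible with `J`; the
tangential Gauss formula then comes from Koszul's formula. -/

noncomputable section
namespace RiemannianGeometry
set_option linter.unusedSectionVars false

/-! ### Smooth germs of functions and vector fields; Lie brackets as commutators -/

section Smoothness

variable {E : Type*} [NormedAddCommGroup E] [NormedSpace ℝ E]
  {M : Type*} [TopologicalSpace M] [ChartedSpace E M]
  {F : Type*} [NormedAddCommGroup F] [NormedSpace ℝ F]

/-- The function `h` is smooth near `x`. -/
def SmoothFnAt (h : M → F) (x : M) : Prop :=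
  ∀ᶠ y in 𝓝 x, ContMDiffAt 𝓘(ℝ, E) 𝓘(ℝ, F) ∞ h y

theorem SmoothFnAt.contMDiffAt {h : M → F} {x : M} (hh : SmoothFnAt (E := E) h x) :
    ContMDiffAt 𝓘(ℝ, E) 𝓘(ℝ, F) ∞ h x := hh.self_of_nhds

theorem SmoothFnAt.mdifferentiableAt {h : M → F} {x : M} (hh : SmoothFnAt (E := E) h x) :
    MDifferentiableAt 𝓘(ℝ, E) 𝓘(ℝ, F) h x := hh.contMDiffAt.mdifferentiableAt (by simp)

/-- Being `C^∞` at one point provides no common neighbourhood for all orders of differentiability.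
Smoothness at all nearby points is an open condition, so identities between germs can be
differentiated repeatedly. -/
theorem SmoothFnAt.eventually {h : M → F} {x : M} (hh : SmoothFnAt (E := E) h x) :
    ∀ᶠ y in 𝓝 x, SmoothFnAt (E := E) h y := eventually_eventually_nhds.2 hh

theorem SmoothFnAt.add {h k : M → F} {x : M} (hh : SmoothFnAt (E := E) h x)
    (hk : SmoothFnAt (E := E) k x) : SmoothFnAt (E := E) (fun y => h y + k y) x := by
  filter_upwards [hh, hk] with y h1 h2 using h1.add h2

theorem SmoothFnAt.sub {h k : M → F} {x : M} (hh : SmoothFnAt (E := E) h x)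
    (hk : SmoothFnAt (E := E) k x) : SmoothFnAt (E := E) (fun y => h y - k y) x := by
  filter_upwards [hh, hk] with y h1 h2 using h1.sub h2

theorem SmoothFnAt.mul {h k : M → ℝ} {x : M} (hh : SmoothFnAt (E := E) h x)
    (hk : SmoothFnAt (E := E) k x) : SmoothFnAt (E := E) (fun y => h y * k y) x := by
  filter_upwards [hh, hk] with y h1 h2 using h1.mul h2

theorem SmoothFnAt.const (c : F) (x : M) : SmoothFnAt (E := E) (fun _ => c) x :=
  .of_forall fun _ => contMDiffAt_const

theorem SmoothFnAt.congr {h k : M → F} {x : M} (hh : SmoothFnAt (E := E) h x)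
    (hk : k =ᶠ[𝓝 x] h) : SmoothFnAt (E := E) k x := by
  filter_upwards [hh, eventually_eventually_nhds.2 hk] with y h1 h2
  exact h1.congr_of_eventuallyEq h2

theorem mvfderiv_congr {h k : M → F} {x : M}
    (hk : ∀ᶠ y in 𝓝 x, h y = k y) : d% h x = d% k x := by
  unfold mvfderiv
  rw [hk.self_of_nhds]
  congr 1
  exact Filter.EventuallyEq.mfderiv_eq hk

/-- Smoothness of a map to continuous linear maps can be checked pointwise. -/
theorem contMDiffAt_clm_of_apply {G : Type*} [NormedAddCommGroup G] [NormedSpace ℝ G]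
    [FiniteDimensional ℝ F] {A : M → F →L[ℝ] G} {x : M}
    (h : ∀ v, ContMDiffAt 𝓘(ℝ, E) 𝓘(ℝ, G) ∞ (fun y => A y v) x) :
    ContMDiffAt 𝓘(ℝ, E) 𝓘(ℝ, F →L[ℝ] G) ∞ A x := by
  let b := Module.finBasis ℝ F
  have h2 : A = fun y => ∑ i, ContinuousLinearMap.smulRightL ℝ F G
      (LinearMap.toContinuousLinearMap (b.coord i)) (A y (b i)) := by
    funext y
    ext v
    conv_lhs => rw [← b.sum_repr v]
    simp [-Module.Basis.sum_repr]
  rw [h2]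
  refine contMDiffAt_finsetSum fun i _ => ?_
  exact (ContinuousLinearMap.contMDiff _).contMDiffAt.comp x (h (b i))

variable [IsManifold 𝓘(ℝ, E) ∞ M]

theorem SmoothAt.contMDiffAt {X : Π x : M, TangentSpace 𝓘(ℝ, E) x} {x : M} (hX : SmoothAt X x) :
    ContMDiffAt 𝓘(ℝ, E) 𝓘(ℝ, E).tangent ∞ (T% X) x := hX.self_of_nhds

theorem SmoothAt.eventually {X : Π x : M, TangentSpace 𝓘(ℝ, E) x} {x : M} (hX : SmoothAt X x) :
    ∀ᶠ y in 𝓝 x, SmoothAt X y := eventually_eventually_nhds.2 hX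

theorem SmoothAt.congr {X Y : Π x : M, TangentSpace 𝓘(ℝ, E) x} {x : M} (hX : SmoothAt X x)
    (hY : ∀ᶠ y in 𝓝 x, Y y = X y) : SmoothAt Y x := by
  filter_upwards [hX, eventually_eventually_nhds.2 hY] with y h1 h2
  refine h1.congr_of_eventuallyEq ?_
  filter_upwards [h2] with z hz
  rw [hz]

/-- `df X` is smooth along `f`. -/
theorem contMDiffAt_mfderiv_apply {M' : Type*} [TopologicalSpace M'] [ChartedSpace F M'] [IsManifold 𝓘(ℝ, F) ∞ M']
    {f : M → M'} {X : Π x : M, TangentSpace 𝓘(ℝ, E) x} {x : M}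
    (hf : ContMDiffAt 𝓘(ℝ, E) 𝓘(ℝ, F) ∞ f x)
    (hX : ContMDiffAt 𝓘(ℝ, E) 𝓘(ℝ, E).tangent ∞ (T% X) x) :
    ContMDiffAt 𝓘(ℝ, E) 𝓘(ℝ, F).tangent ∞
      (fun y => (⟨f y, mfderiv 𝓘(ℝ, E) 𝓘(ℝ, F) f y (X y)⟩ : TangentBundle 𝓘(ℝ, F) M')) x := by
  have h1 := hf.mfderiv_const (m := ∞) (by simp)
  exact ContMDiffAt.clm_apply_of_inCoordinates (F₁ := E) (F₂ := F)
    (E₁ := fun x : M => TangentSpace 𝓘(ℝ, E) x) (E₂ := fun x : M' => TangentSpace 𝓘(ℝ, F) x)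
    (b₁ := id) (b₂ := f) h1 hX hf

theorem SmoothFnAt.mvfderiv {h : M → F}
    {X : Π x : M, TangentSpace 𝓘(ℝ, E) x} {x : M}
    (hh : SmoothFnAt (E := E) h x) (hX : SmoothAt X x) :
    SmoothFnAt (E := E) (fun y => d% h y (X y)) x := by
  filter_upwards [hh, hX] with y h1 h2
  have := contMDiffAt_mfderiv_apply h1 h2
  rw [contMDiffAt_totalSpace] at this
  have h3 := this.2
  simp only [mfld_simps] at h3
  exact h3

theorem SmoothAt.mdifferentiableAt {X : Π x : M, TangentSpace 𝓘(ℝ, E) x} {x : M}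
    (hX : SmoothAt X x) : MDiffAt (T% X) x := hX.contMDiffAt.mdifferentiableAt (by simp)

theorem smoothAt_extend {x : M} (v : TangentSpace 𝓘(ℝ, E) x) : SmoothAt (extend E v) x := by
  obtain ⟨s, hs, h⟩ := exists_contMDiffOn_extend (k := ∞) 𝓘(ℝ, E) E v
  filter_upwards [eventually_mem_nhds_iff.2 hs] with y hy
  exact h.contMDiffAt hy

theorem SmoothAt.add {X Y : Π x : M, TangentSpace 𝓘(ℝ, E) x} {x : M}
    (hX : SmoothAt X x) (hY : SmoothAt Y x) : SmoothAt (fun y => X y + Y y) x := by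
  filter_upwards [hX, hY] with y h1 h2 using h1.add_section h2

theorem SmoothAt.sub {X Y : Π x : M, TangentSpace 𝓘(ℝ, E) x} {x : M}
    (hX : SmoothAt X x) (hY : SmoothAt Y x) : SmoothAt (fun y => X y - Y y) x := by
  filter_upwards [hX, hY] with y h1 h2 using h1.sub_section h2

theorem SmoothAt.smul {h : M → ℝ} {X : Π x : M, TangentSpace 𝓘(ℝ, E) x} {x : M}
    (hh : SmoothFnAt (E := E) h x) (hX : SmoothAt X x) : SmoothAt (fun y => h y • X y) x := by
  filter_upwards [hh, hX] with y h1 h2 using h1.smul_section h2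

theorem isManifold_minSmoothness_two : IsManifold 𝓘(ℝ, E) (minSmoothness ℝ 2) M :=
  .of_le (n := ∞) (by simp; exact ENat.LEInfty.out)

theorem isManifold_minSmoothness_three : IsManifold 𝓘(ℝ, E) (minSmoothness ℝ 3) M :=
  .of_le (n := ∞) (by simp; exact ENat.LEInfty.out)

theorem SmoothAt.mlieBracket [CompleteSpace E] {X Y : Π x : M, TangentSpace 𝓘(ℝ, E) x} {x : M}
    (hX : SmoothAt X x) (hY : SmoothAt Y x) : SmoothAt (mlieBracket 𝓘(ℝ, E) X Y) x := by
  have := isManifold_minSmoothness_two (E := E) (M := M)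
  have : IsManifold 𝓘(ℝ, E) ((⊤ : ℕ∞) + 1) M := inferInstanceAs (IsManifold 𝓘(ℝ, E) ∞ M)
  filter_upwards [hX, hY] with y h1 h2
  exact ContMDiffAt.mlieBracket_vectorField (m := ⊤) (n := ⊤) h1 h2 (by simp)

theorem SmoothAt.clm_apply {A : Π x : M, TangentSpace 𝓘(ℝ, E) x →L[ℝ] TangentSpace 𝓘(ℝ, E) x}
    (hA : ContMDiff 𝓘(ℝ, E) (𝓘(ℝ, E).prod 𝓘(ℝ, E →L[ℝ] E)) ∞
      (fun x => TotalSpace.mk' (E →L[ℝ] E)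
        (E := fun x : M => TangentSpace 𝓘(ℝ, E) x →L[ℝ] TangentSpace 𝓘(ℝ, E) x) x (A x)))
    {X : Π x : M, TangentSpace 𝓘(ℝ, E) x} {x : M} (hX : SmoothAt X x) :
    SmoothAt (fun y => A y (X y)) x := by
  filter_upwards [hX] with y hy
  exact (hA y).clm_bundle_apply hy

/-- The Jacobi identity for `X`, `Y`, `hZ`, expanded by the Leibniz rule and compared with that for
`X`, `Y`, `Z`, leaves `(X(Yh) - Y(Xh) - [X,Y]h) Z = 0` at `x`. A field `Z` nonzero at `x` then
yields the formula; a zero tangent space is treated separately. -/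
theorem mvfderiv_mlieBracket_real [FiniteDimensional ℝ E] {h : M → ℝ}
    {X Y : Π x : M, TangentSpace 𝓘(ℝ, E) x} {x : M}
    (hh : SmoothFnAt (E := E) h x) (hX : SmoothAt X x) (hY : SmoothAt Y x) :
    d% (fun y => d% h y (Y y)) x (X x) - d% (fun y => d% h y (X y)) x (Y x) =
      d% h x (mlieBracket 𝓘(ℝ, E) X Y x) := by
  rcases subsingleton_or_nontrivial (TangentSpace 𝓘(ℝ, E) x) with hs | hs
  · rw [Subsingleton.elim (X x) 0, Subsingleton.elim (Y x) 0,
      Subsingleton.elim (mlieBracket 𝓘(ℝ, E) X Y x) 0]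
    simp
  obtain ⟨v, hv⟩ := exists_ne (0 : TangentSpace 𝓘(ℝ, E) x)
  have : CompleteSpace E := FiniteDimensional.complete ℝ E
  have key : ∀ {X Y Z : Π x : M, TangentSpace 𝓘(ℝ, E) x}, SmoothAt X x → SmoothAt Y x →
      SmoothAt Z x → VectorField.mlieBracket 𝓘(ℝ, E) X (VectorField.mlieBracket 𝓘(ℝ, E) Y (h • Z)) x =
        d% (fun y => d% h y (Y y)) x (X x) • Z x
          + d% h x (Y x) • VectorField.mlieBracket 𝓘(ℝ, E) X Z x
          + (d% h x (X x) • VectorField.mlieBracket 𝓘(ℝ, E) Y Z x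
            + h x • VectorField.mlieBracket 𝓘(ℝ, E) X (VectorField.mlieBracket 𝓘(ℝ, E) Y Z) x) := by
    intro X Y Z hX hY hZ
    have h1 : VectorField.mlieBracket 𝓘(ℝ, E) Y (h • Z) =ᶠ[𝓝 x]
        ((fun y => d% h y (Y y)) • Z + h • VectorField.mlieBracket 𝓘(ℝ, E) Y Z) := by
      filter_upwards [hh.eventually, hZ.eventually] with y h1 h2
      exact mlieBracket_smul_right h1.mdifferentiableAt h2.mdifferentiableAt
    have h2 := Filter.EventuallyEq.mlieBracket_vectorField_eq (V := X) (.refl _ X) h1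
    rw [h2,
      mlieBracket_add_right (W := (fun y => d% h y (Y y)) • Z)
        (W₁ := h • VectorField.mlieBracket 𝓘(ℝ, E) Y Z)
        (SmoothAt.smul (hh.mvfderiv hY) hZ).mdifferentiableAt
        (SmoothAt.smul hh (hY.mlieBracket hZ)).mdifferentiableAt,
      mlieBracket_smul_right (hh.mvfderiv hY).mdifferentiableAt hZ.mdifferentiableAt,
      mlieBracket_smul_right hh.mdifferentiableAt (hY.mlieBracket hZ).mdifferentiableAt]
  have hZ := smoothAt_extend v
  set Z := extend E v
  have hZx : Z x = v := extend_apply_self ..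
  have le : ∀ {X : Π x : M, TangentSpace 𝓘(ℝ, E) x}, SmoothAt X x →
      ContMDiffAt 𝓘(ℝ, E) 𝓘(ℝ, E).tangent (minSmoothness ℝ 2) (T% X) x :=
    fun h => h.contMDiffAt.of_le (by simp; exact ENat.LEInfty.out)
  have := isManifold_minSmoothness_three (E := E) (M := M)
  have j1 := leibniz_identity_mlieBracket_apply (le hX) (le hY) (le (SmoothAt.smul hh hZ))
  have j2 := leibniz_identity_mlieBracket_apply (le hX) (le hY) (le hZ)
  have j3 := key hX hY hZ
  have j4 := key hY hX hZ
  have j5 := mlieBracket_smul_right (V := VectorField.mlieBracket 𝓘(ℝ, E) X Y)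
    hh.mdifferentiableAt hZ.mdifferentiableAt
  have j1' : VectorField.mlieBracket 𝓘(ℝ, E) X (VectorField.mlieBracket 𝓘(ℝ, E) Y (h • Z)) x =
    VectorField.mlieBracket 𝓘(ℝ, E) (VectorField.mlieBracket 𝓘(ℝ, E) X Y) (h • Z) x
      + VectorField.mlieBracket 𝓘(ℝ, E) Y (VectorField.mlieBracket 𝓘(ℝ, E) X (h • Z)) x := j1
  rw [j3, j4, j5, j2, hZx] at j1'
  have : (d% (fun y => d% h y (Y y)) x (X x) - d% (fun y => d% h y (X y)) x (Y x) -
      d% h x (VectorField.mlieBracket 𝓘(ℝ, E) X Y x)) • v = 0 := by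
    rw [← sub_eq_zero] at j1'
    rw [← j1']
    module
  have := (smul_eq_zero.1 this).resolve_right hv
  linarith

/-- `X (Y h) - Y (X h) = [X, Y] h`. -/
theorem mvfderiv_mlieBracket [FiniteDimensional ℝ E] {h : M → F}
    {X Y : Π x : M, TangentSpace 𝓘(ℝ, E) x} {x : M}
    (hh : SmoothFnAt (E := E) h x) (hX : SmoothAt X x) (hY : SmoothAt Y x) :
    d% (fun y => d% h y (Y y)) x (X x) - d% (fun y => d% h y (X y)) x (Y x) =
      d% h x (mlieBracket 𝓘(ℝ, E) X Y x) := by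
  -- Continuous functionals separate points of `F` and commute with derivatives, so the scalar case
  -- suffices.
  refine (SeparatingDual.eq_iff_forall_dual_eq (R := ℝ)).2 fun L => ?_
  have comp : ∀ {k : M → F} {y : M}, MDifferentiableAt 𝓘(ℝ, E) 𝓘(ℝ, F) k y →
      ∀ v, d% (fun z => L (k z)) y v = L (d% k y v) := by
    intro k y hk v
    have h1 := mvfderiv_comp_apply (g := L) (f := k) y
      L.differentiableAt.mdifferentiableAt hk v
    refine h1.trans ?_
    simp only [mvfderiv, mfderiv_eq_fderiv]
    simp
    rfl
  have hL : SmoothFnAt (E := E) (fun y => L (h y)) x := by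
    filter_upwards [hh] with y hy
    exact L.contMDiff.contMDiffAt.comp y hy
  have h0 := mvfderiv_mlieBracket_real hL hX hY
  have ev : ∀ Z : Π x : M, TangentSpace 𝓘(ℝ, E) x, SmoothAt Z x →
      d% (fun y => d% (fun z => L (h z)) y (Z y)) x = d% (fun y => L (d% h y (Z y))) x := by
    intro Z hZ
    unfold mvfderiv
    congr 1
    apply Filter.EventuallyEq.mfderiv_eq
    filter_upwards [hh.eventually] with y hy using comp hy.mdifferentiableAt _
  rw [ev Y hY, ev X hX, comp (hh.mvfderiv hY).mdifferentiableAt,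
    comp (hh.mvfderiv hX).mdifferentiableAt, comp hh.mdifferentiableAt] at h0
  rw [map_sub, h0]

end Smoothness

/-! ### Smoothness of covariant derivatives and symmetries of the curvature -/

section LeviCivita

variable {E : Type*} [NormedAddCommGroup E] [NormedSpace ℝ E] [FiniteDimensional ℝ E]
  {M : Type*} [TopologicalSpace M] [ChartedSpace E M] [IsManifold 𝓘(ℝ, E) ∞ M]
  [RiemannianBundle (fun x : M => TangentSpace 𝓘(ℝ, E) x)]
  [IsContMDiffRiemannianBundle 𝓘(ℝ, E) ∞ E (fun x : M => TangentSpace 𝓘(ℝ, E) x)]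

theorem SmoothAt.inner_fun {X Y : Π x : M, TangentSpace 𝓘(ℝ, E) x} {x : M}
    (hX : SmoothAt X x) (hY : SmoothAt Y x) :
    SmoothFnAt (E := E) (fun y => (inner ℝ (X y) (Y y) : ℝ)) x := by
  filter_upwards [hX, hY] with y h1 h2
  exact ContMDiffAt.inner_bundle (F := E) (E := fun x : M => TangentSpace 𝓘(ℝ, E) x) h1 h2

/-- A vector field is smooth if its inner products with smooth vector fields are. -/
theorem contMDiffAt_of_inner {V : Π x : M, TangentSpace 𝓘(ℝ, E) x} {x : M}
    (hV : ∀ Z : Π x : M, TangentSpace 𝓘(ℝ, E) x, SmoothAt Z x →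
      ContMDiffAt 𝓘(ℝ, E) 𝓘(ℝ) ∞ (fun y => (inner ℝ (V y) (Z y) : ℝ)) x) :
    ContMDiffAt 𝓘(ℝ, E) 𝓘(ℝ, E).tangent ∞ (T% V) x := by
  rw [contMDiffAt_section]
  set t := trivializationAt E (fun p : M => TangentSpace 𝓘(ℝ, E) p) x with ht
  have hbase : ∀ᶠ y in 𝓝 x, y ∈ t.baseSet :=
    t.open_baseSet.mem_nhds (mem_baseSet_trivializationAt' x)
  -- `G` is the Gram form of the metric in the trivialization and `c` the form `g(V, ·)`; the
  -- coordinates of `V` are `G⁻¹ c`. Positive definiteness makes `G` invertible, and inversion is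
  -- smooth.
  let G : M → E →L[ℝ] E →L[ℝ] ℝ := fun y =>
    (innerSL ℝ (E := TangentSpace 𝓘(ℝ, E) y)).bilinearComp (t.symmL ℝ y) (t.symmL ℝ y)
  have ext_eq : ∀ v : E, ∃ Z : Π x : M, TangentSpace 𝓘(ℝ, E) x, SmoothAt Z x ∧
      ∀ y ∈ t.baseSet, t.symmL ℝ y v = Z y := by
    intro v
    refine ⟨extend E (t.symmL ℝ x v), smoothAt_extend _, fun y hy => ?_⟩
    have hx : x ∈ t.baseSet := mem_baseSet_trivializationAt' x
    have h1 : (t ⟨x, t.symmL ℝ x v⟩).2 = v := by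
      rw [Trivialization.symmL_apply _ hx]
      exact congrArg Prod.snd (t.apply_mk_symm hx v)
    rw [Trivialization.symmL_apply _ hy]
    unfold extend
    rw [← ht, h1]
  have hG : ContMDiffAt 𝓘(ℝ, E) 𝓘(ℝ, E →L[ℝ] E →L[ℝ] ℝ) ∞ G x := by
    refine contMDiffAt_clm_of_apply fun u => contMDiffAt_clm_of_apply fun v => ?_
    obtain ⟨U, hU, hU'⟩ := ext_eq u
    obtain ⟨W, hW, hW'⟩ := ext_eq v
    refine (hU.inner_fun hW).contMDiffAt.congr_of_eventuallyEq ?_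
    filter_upwards [hbase] with y hy
    simp [G, hU' y hy, hW' y hy]
  let c : M → E →L[ℝ] ℝ := fun y => innerSL ℝ (V y) ∘L t.symmL ℝ y
  have hc : ContMDiffAt 𝓘(ℝ, E) 𝓘(ℝ, E →L[ℝ] ℝ) ∞ c x := by
    refine contMDiffAt_clm_of_apply fun v => ?_
    obtain ⟨Z, hZ, hZ'⟩ := ext_eq v
    refine (hV Z hZ).congr_of_eventuallyEq ?_
    filter_upwards [hbase] with y hy
    simp [c, hZ' y hy]
  have hinv : ∀ y ∈ t.baseSet, (G y).IsInvertible := by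
    intro y hy
    have hinj : Function.Injective (G y : E →ₗ[ℝ] E →L[ℝ] ℝ) := by
      rw [← LinearMap.ker_eq_bot, LinearMap.ker_eq_bot']
      intro u hu
      have h1 : (inner ℝ (t.symmL ℝ y u) (t.symmL ℝ y u) : ℝ) = 0 := congr($hu u)
      have h2 := inner_self_eq_zero.1 h1
      have h3 := t.continuousLinearMapAt_symmL (R := ℝ) hy u
      rw [h2, map_zero] at h3
      exact h3.symm
    have hdim : Module.finrank ℝ E = Module.finrank ℝ (E →L[ℝ] ℝ) := by
      rw [← (LinearMap.toContinuousLinearMap (𝕜 := ℝ) (E := E) (F' := ℝ)).finrank_eq]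
      exact (Subspace.dual_finrank_eq (K := ℝ) (V := E)).symm
    exact ⟨(LinearEquiv.ofInjectiveOfFinrankEq (G y : E →ₗ[ℝ] E →L[ℝ] ℝ) hinj hdim).toContinuousLinearEquiv, by
      ext; rfl⟩
  have hx : x ∈ t.baseSet := mem_baseSet_trivializationAt' x
  have h1 : ContMDiffAt 𝓘(ℝ, E) 𝓘(ℝ, (E →L[ℝ] ℝ) →L[ℝ] E) ∞ (fun y => (G y).inverse) x :=
    (hinv x hx).contDiffAt_map_inverse.contMDiffAt.comp x hG
  refine (h1.clm_apply hc).congr_of_eventuallyEq ?_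
  filter_upwards [hbase] with y hy
  have h2 : c y = G y (t ⟨y, V y⟩).2 := by
    ext v
    have h3 : t.symmL ℝ y (t ⟨y, V y⟩).2 = V y := by
      rw [Trivialization.symmL_apply _ hy]
      exact t.symm_apply_apply_mk hy (V y)
    simp [c, G, h3]
  rw [h2]
  obtain ⟨e, he⟩ := hinv y hy
  rw [← he]
  simp

theorem SmoothAt.of_inner {V : Π x : M, TangentSpace 𝓘(ℝ, E) x} {x : M}
    (hV : ∀ᶠ y in 𝓝 x, ∀ Z : Π x : M, TangentSpace 𝓘(ℝ, E) x, SmoothAt Z y →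
      SmoothFnAt (E := E) (fun y => (inner ℝ (V y) (Z y) : ℝ)) y) : SmoothAt V x := by
  filter_upwards [hV] with y hy
  exact contMDiffAt_of_inner fun Z hZ => (hy Z hZ).contMDiffAt

theorem inner_leviCivita {Y X Z : Π x : M, TangentSpace 𝓘(ℝ, E) x} {x : M}
    (hY : MDiffAt (T% Y) x) (hX : MDiffAt (T% X) x) (hZ : MDiffAt (T% Z) x) :
    (inner ℝ (leviCivita E M Y x (X x)) (Z x) : ℝ) = 1 / 2 * koszul Y X Z x :=
  inner_leviCivitaAux hY hX hZ

/-- The covariant derivative of a smooth vector field along a smooth vector field is smooth. -/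
theorem SmoothAt.leviCivita {X Y : Π x : M, TangentSpace 𝓘(ℝ, E) x} {x : M}
    (hY : SmoothAt Y x) (hX : SmoothAt X x) :
    SmoothAt (fun y => leviCivita E M Y y (X y)) x := by
  have : CompleteSpace E := FiniteDimensional.complete ℝ E
  refine .of_inner ?_
  filter_upwards [hX.eventually, hY.eventually] with y hX hY Z hZ
  -- Koszul's formula expresses the inner products of `∇_X Y` with smooth fields through derivatives
  -- and brackets of smooth data, so the test by inner products applies.
  have h1 : SmoothFnAt (E := E) (fun y => 1 / 2 * koszul Y X Z y) y := by
    unfold koszul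
    exact (SmoothFnAt.const _ _).mul (((((((hY.inner_fun hZ).mvfderiv hX).add
      ((hZ.inner_fun hX).mvfderiv hY)).sub ((hX.inner_fun hY).mvfderiv hZ)).add
      ((hX.mlieBracket hY).inner_fun hZ)).sub ((hX.mlieBracket hZ).inner_fun hY)).sub
      ((hY.mlieBracket hZ).inner_fun hX))
  refine h1.congr ?_
  filter_upwards [hX.eventually, hY.eventually, hZ.eventually] with z h1 h2 h3
  exact inner_leviCivita h2.mdifferentiableAt h1.mdifferentiableAt h3.mdifferentiableAt

theorem leviCivita_congr {Y Y' : Π x : M, TangentSpace 𝓘(ℝ, E) x} {x : M}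
    (hY : SmoothAt Y x) (h : ∀ᶠ y in 𝓝 x, Y' y = Y y) :
    RiemannianGeometry.leviCivita E M Y' x = RiemannianGeometry.leviCivita E M Y x :=
  (RiemannianGeometry.leviCivita E M).isCovariantDerivativeOnUniv.congr_of_eventuallyEq
    (hY.congr h).mdifferentiableAt hY.mdifferentiableAt Filter.univ_mem h

theorem leviCivita_add {Y Y' : Π x : M, TangentSpace 𝓘(ℝ, E) x} {x : M}
    (hY : SmoothAt Y x) (hY' : SmoothAt Y' x) :
    leviCivita E M (fun y => Y y + Y' y) x = leviCivita E M Y x + leviCivita E M Y' x :=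
  (leviCivita E M).isCovariantDerivativeOnUniv.add hY.mdifferentiableAt hY'.mdifferentiableAt

theorem leviCivita_smul {h : M → ℝ} {Y : Π x : M, TangentSpace 𝓘(ℝ, E) x} {x : M}
    (hh : SmoothFnAt (E := E) h x) (hY : SmoothAt Y x) (v : TangentSpace 𝓘(ℝ, E) x) :
    leviCivita E M (fun y => h y • Y y) x v = h x • leviCivita E M Y x v + d% h x v • Y x := by
  have := (leviCivita E M).isCovariantDerivativeOnUniv.leibniz hY.mdifferentiableAt
    hh.mdifferentiableAt
  exact congr($this v)

theorem leviCivita_sub {Y Y' : Π x : M, TangentSpace 𝓘(ℝ, E) x} {x : M}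
    (hY : SmoothAt Y x) (hY' : SmoothAt Y' x) :
    leviCivita E M (fun y => Y y - Y' y) x = leviCivita E M Y x - leviCivita E M Y' x := by
  rw [eq_sub_iff_add_eq, ← leviCivita_add (hY.sub hY') hY']
  simp

theorem mlieBracket_eq_leviCivita {X Y : Π x : M, TangentSpace 𝓘(ℝ, E) x} {x : M}
    (hX : SmoothAt X x) (hY : SmoothAt Y x) : mlieBracket 𝓘(ℝ, E) X Y x =
      leviCivita E M Y x (X x) - leviCivita E M X x (Y x) :=
  ((CovariantDerivative.torsion_eq_zero_iff _).1 (leviCivita_torsion (E := E) (M := M))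
    hX.mdifferentiableAt hY.mdifferentiableAt).symm

theorem mvfderiv_inner {X Y Z : Π x : M, TangentSpace 𝓘(ℝ, E) x} {x : M}
    (hX : SmoothAt X x) (hY : SmoothAt Y x) (hZ : SmoothAt Z x) :
    d% (fun y => (inner ℝ (Y y) (Z y) : ℝ)) x (X x) =
      inner ℝ (leviCivita E M Y x (X x)) (Z x) + inner ℝ (Y x) (leviCivita E M Z x (X x)) :=
  leviCivita_inner hX.mdifferentiableAt hY.mdifferentiableAt hZ.mdifferentiableAt

/-- The operator `XY - YX - [X,Y]` kills the function `g(Z,Z)`. Expanded by metric compatibility,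
the products of first derivatives are symmetric in `X`, `Y` and cancel, leaving `2 g(R(X,Y)Z, Z)`.
-/
theorem inner_curvature_self {X Y Z : Π x : M, TangentSpace 𝓘(ℝ, E) x} {x : M}
    (hX : SmoothAt X x) (hY : SmoothAt Y x) (hZ : SmoothAt Z x) :
    (inner ℝ (curvature X Y Z x) (Z x) : ℝ) = 0 := by
  have : CompleteSpace E := FiniteDimensional.complete ℝ E
  have key := mvfderiv_mlieBracket (hZ.inner_fun hZ) hX hY
  rw [mvfderiv_inner (hX.mlieBracket hY) hZ hZ] at key
  have aux : ∀ {X Y : Π x : M, TangentSpace 𝓘(ℝ, E) x}, SmoothAt X x → SmoothAt Y x →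
      d% (fun y => d% (fun y => (inner ℝ (Z y) (Z y) : ℝ)) y (Y y)) x (X x) =
      2 * (inner ℝ (leviCivita E M (fun y => leviCivita E M Z y (Y y)) x (X x)) (Z x)
        + inner ℝ (leviCivita E M Z x (Y x)) (leviCivita E M Z x (X x))) := by
    intro X Y hX hY
    have h1 : ∀ᶠ y in 𝓝 x, d% (fun y => (inner ℝ (Z y) (Z y) : ℝ)) y (Y y) =
        inner ℝ (leviCivita E M Z y (Y y)) (Z y) + inner ℝ (leviCivita E M Z y (Y y)) (Z y) := by
      filter_upwards [hY.eventually, hZ.eventually] with y h1 h2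
      rw [mvfderiv_inner h1 h2 h2, real_inner_comm (leviCivita E M Z y (Y y)) (Z y)]
    have h2 := ((hZ.leviCivita hY).inner_fun hZ).mdifferentiableAt
    rw [mvfderiv_congr h1, mvfderiv_fun_add h2 h2]
    simp only [add_apply, mvfderiv_inner hX (hZ.leviCivita hY) hZ]
    ring
  rw [aux hX hY, aux hY hX] at key
  simp only [curvature, inner_sub_left]
  rw [real_inner_comm (leviCivita E M Z x (X x)),
    real_inner_comm (leviCivita E M Z x (mlieBracket 𝓘(ℝ, E) X Y x))] at key
  linarith

theorem curvature_swap (X Y Z : Π x : M, TangentSpace 𝓘(ℝ, E) x) (x : M) :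
    curvature X Y Z x = -curvature Y X Z x := by
  simp only [curvature, mlieBracket_swap_apply (V := Y) (W := X), map_neg]
  abel

theorem curvature_add_right {X Y Z W : Π x : M, TangentSpace 𝓘(ℝ, E) x} {x : M}
    (hX : SmoothAt X x) (hY : SmoothAt Y x) (hZ : SmoothAt Z x) (hW : SmoothAt W x) :
    curvature X Y (fun y => Z y + W y) x = curvature X Y Z x + curvature X Y W x := by
  have aux : ∀ {X Y : Π x : M, TangentSpace 𝓘(ℝ, E) x}, SmoothAt X x → SmoothAt Y x →
      leviCivita E M (fun y => leviCivita E M (fun y => Z y + W y) y (Y y)) x =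
      leviCivita E M (fun y => leviCivita E M Z y (Y y)) x
        + leviCivita E M (fun y => leviCivita E M W y (Y y)) x := by
    intro X Y hX hY
    rw [← leviCivita_add (hZ.leviCivita hY) (hW.leviCivita hY)]
    refine leviCivita_congr ((hZ.leviCivita hY).add (hW.leviCivita hY)) ?_
    filter_upwards [hZ.eventually, hW.eventually] with y h1 h2
    rw [leviCivita_add h1 h2]
    rfl
  simp only [curvature, aux hX hY, aux hY hX, leviCivita_add hZ hW, add_apply]
  abel

/-- Polarization of `inner_curvature_self` at `Z + W`. -/
theorem inner_curvature_swap {X Y Z W : Π x : M, TangentSpace 𝓘(ℝ, E) x} {x : M}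
    (hX : SmoothAt X x) (hY : SmoothAt Y x) (hZ : SmoothAt Z x) (hW : SmoothAt W x) :
    (inner ℝ (curvature X Y Z x) (W x) : ℝ) = -inner ℝ (curvature X Y W x) (Z x) := by
  have h := inner_curvature_self hX hY (hZ.add hW)
  rw [curvature_add_right hX hY hZ hW] at h
  simp only [inner_add_left, inner_add_right, inner_curvature_self hX hY hZ,
    inner_curvature_self hX hY hW] at h
  linarith

/-- The first Bianchi identity. -/
theorem curvature_bianchi {X Y Z : Π x : M, TangentSpace 𝓘(ℝ, E) x} {x : M}
    (hX : SmoothAt X x) (hY : SmoothAt Y x) (hZ : SmoothAt Z x) :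
    curvature X Y Z x + curvature Y Z X x + curvature Z X Y x = 0 := by
  have : CompleteSpace E := FiniteDimensional.complete ℝ E
  have le : ∀ {X : Π x : M, TangentSpace 𝓘(ℝ, E) x}, SmoothAt X x →
      ContMDiffAt 𝓘(ℝ, E) 𝓘(ℝ, E).tangent (minSmoothness ℝ 2) (T% X) x :=
    fun h => h.contMDiffAt.of_le (by simp; exact ENat.LEInfty.out)
  have := isManifold_minSmoothness_three (E := E) (M := M)
  -- With every bracket written as a difference of covariant derivatives by vanishing torsion, the
  -- Jacobi identity becomes the Bianchi identity.
  have jac := leibniz_identity_mlieBracket_apply (le hX) (le hY) (le hZ)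
  have aux : ∀ {X Y Z : Π x : M, TangentSpace 𝓘(ℝ, E) x}, SmoothAt X x → SmoothAt Y x →
      SmoothAt Z x → mlieBracket 𝓘(ℝ, E) X (mlieBracket 𝓘(ℝ, E) Y Z) x =
        leviCivita E M (fun y => leviCivita E M Z y (Y y)) x (X x)
        - leviCivita E M (fun y => leviCivita E M Y y (Z y)) x (X x)
        - leviCivita E M X x (mlieBracket 𝓘(ℝ, E) Y Z x) := by
    intro X Y Z hX hY hZ
    rw [mlieBracket_eq_leviCivita hX (hY.mlieBracket hZ)]
    have h1 : ∀ᶠ y in 𝓝 x, mlieBracket 𝓘(ℝ, E) Y Z y =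
        leviCivita E M Z y (Y y) - leviCivita E M Y y (Z y) := by
      filter_upwards [hY.eventually, hZ.eventually] with y h1 h2
        using mlieBracket_eq_leviCivita h1 h2
    rw [leviCivita_congr ((hZ.leviCivita hY).sub (hY.leviCivita hZ)) h1,
      leviCivita_sub (hZ.leviCivita hY) (hY.leviCivita hZ)]
    rfl
  rw [mlieBracket_swap_apply (V := mlieBracket 𝓘(ℝ, E) X Y), aux hX hY hZ, aux hZ hX hY,
    aux hY hX hZ] at jac
  simp only [curvature]
  rw [mlieBracket_swap_apply (V := Z) (W := X), map_neg]
  rw [← sub_eq_zero] at jac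
  rw [← jac]
  abel

/-- Pair symmetry of the Riemann tensor. -/
theorem inner_curvature_pair_symm {X Y Z W : Π x : M, TangentSpace 𝓘(ℝ, E) x} {x : M}
    (hX : SmoothAt X x) (hY : SmoothAt Y x) (hZ : SmoothAt Z x) (hW : SmoothAt W x) :
    (inner ℝ (curvature X Y Z x) (W x) : ℝ) = inner ℝ (curvature Z W X x) (Y x) := by
  have b : ∀ {X Y Z W : Π x : M, TangentSpace 𝓘(ℝ, E) x}, SmoothAt X x → SmoothAt Y x →
      SmoothAt Z x → (inner ℝ (curvature X Y Z x) (W x) : ℝ) + inner ℝ (curvature Y Z X x) (W x)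
        + inner ℝ (curvature Z X Y x) (W x) = 0 := by
    intro X Y Z W hX hY hZ
    rw [← inner_add_left, ← inner_add_left, curvature_bianchi hX hY hZ, inner_zero_left]
  -- The classical octahedron argument: four Bianchi identities, one for each choice of the slot
  -- left out of the cyclic sum, combined linearly with the two antisymmetries.
  have b1 := b (W := W) hX hY hZ
  have b2 := b (W := X) hY hZ hW
  have b3 := b (W := Y) hZ hW hX
  have b4 := b (W := Z) hW hX hY
  have s : ∀ {X Y : Π x : M, TangentSpace 𝓘(ℝ, E) x} (Z W : Π x : M, TangentSpace 𝓘(ℝ, E) x),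
      (inner ℝ (curvature X Y Z x) (W x) : ℝ) = -inner ℝ (curvature Y X Z x) (W x) := by
    intro X Y Z W
    rw [curvature_swap, inner_neg_left]
  have a1 := inner_curvature_swap hX hY hZ hW
  have a2 := inner_curvature_swap hY hZ hX hW
  have a3 := inner_curvature_swap hZ hX hY hW
  have a4 := inner_curvature_swap hZ hW hX hY
  have a5 := inner_curvature_swap hX hW hY hZ
  have a6 := inner_curvature_swap hY hW hX hZ
  have s1 := s (X := W) (Y := X) Y Z
  have s2 := s (X := W) (Y := Y) X Z
  have s3 := s (X := W) (Y := Y) Z X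
  have s4 := s (X := W) (Y := X) Z Y
  have s5 := s (X := X) (Y := W) Z Y
  have s6 := s (X := X) (Y := Z) Y W
  have s7 := s (X := X) (Y := Z) W Y
  linarith

end LeviCivita

/-! ### The pulled-back connection along `f` and the tangential Gauss formula -/

section Along

variable {E : Type*} [NormedAddCommGroup E] [NormedSpace ℝ E] [FiniteDimensional ℝ E]
  {M : Type*} [TopologicalSpace M] [ChartedSpace E M] [IsManifold 𝓘(ℝ, E) ∞ M]
  {E' : Type*} [NormedAddCommGroup E'] [NormedSpace ℝ E'] [FiniteDimensional ℝ E']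
  {M' : Type*} [TopologicalSpace M'] [ChartedSpace E' M'] [IsManifold 𝓘(ℝ, E') ∞ M']

variable (E) in
/-- The vector field `s` along `f` is differentiable at `x`. -/
def MDiffAlong (f : M → M') (s : Π x : M, TangentSpace 𝓘(ℝ, E') (f x)) (x : M) : Prop :=
  MDifferentiableAt 𝓘(ℝ, E) 𝓘(ℝ, E').tangent
    (fun y => (⟨f y, s y⟩ : TangentBundle 𝓘(ℝ, E') M')) x

section

variable {f : M → M'} {s s' : Π x : M, TangentSpace 𝓘(ℝ, E') (f x)} {x : M}

theorem mvfderiv_comp_eq {F : Type*} [NormedAddCommGroup F] [NormedSpace ℝ F] {h : M' → F}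
    (hh : MDifferentiableAt 𝓘(ℝ, E') 𝓘(ℝ, F) h (f x))
    (hf : MDifferentiableAt 𝓘(ℝ, E) 𝓘(ℝ, E') f x) (v : TangentSpace 𝓘(ℝ, E) x) :
    d% (fun y => h (f y)) x v = d% h (f x) (mfderiv 𝓘(ℝ, E) 𝓘(ℝ, E') f x v) :=
  mfderiv_comp_apply x hh hf v

theorem MDiffAlong.base (hs : MDiffAlong E f s x) : MDifferentiableAt 𝓘(ℝ, E) 𝓘(ℝ, E') f x :=
  ((mdifferentiableAt_totalSpace _ _).1 hs).1

theorem MDiffAlong.coord (hs : MDiffAlong E f s x) : MDifferentiableAt 𝓘(ℝ, E) 𝓘(ℝ, E')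
    (fun y => (trivializationAt E' (fun p : M' => TangentSpace 𝓘(ℝ, E') p) (f x) ⟨f y, s y⟩).2) x :=
  ((mdifferentiableAt_totalSpace _ _).1 hs).2

theorem MDiffAlong.of_coord (hf : MDifferentiableAt 𝓘(ℝ, E) 𝓘(ℝ, E') f x)
    (hs : MDifferentiableAt 𝓘(ℝ, E) 𝓘(ℝ, E')
      (fun y => (trivializationAt E' (fun p : M' => TangentSpace 𝓘(ℝ, E') p) (f x) ⟨f y, s y⟩).2) x) :
    MDiffAlong E f s x :=
  (mdifferentiableAt_totalSpace _ _).2 ⟨hf, hs⟩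

theorem MDiffAlong.comp (hf : MDifferentiableAt 𝓘(ℝ, E) 𝓘(ℝ, E') f x)
    {Y : Π p : M', TangentSpace 𝓘(ℝ, E') p} (hY : MDiffAt (T% Y) (f x)) :
    MDiffAlong E f (fun y => Y (f y)) x :=
  MDifferentiableAt.comp x hY hf

theorem eventually_mem_baseSet {f : M → M'} {x : M} (hf : ContinuousAt f x) : ∀ᶠ y in 𝓝 x, f y ∈
    (trivializationAt E' (fun p : M' => TangentSpace 𝓘(ℝ, E') p) (f x)).baseSet :=
  hf ((trivializationAt E' (fun p : M' => TangentSpace 𝓘(ℝ, E') p) (f x)).open_baseSet.mem_nhds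
    (mem_baseSet_trivializationAt' (f x)))

theorem coord_add_eventuallyEq (hf : ContinuousAt f x) : ∀ᶠ y in 𝓝 x,
    (trivializationAt E' (fun p : M' => TangentSpace 𝓘(ℝ, E') p) (f x) ⟨f y, s y + s' y⟩).2 =
    (trivializationAt E' (fun p : M' => TangentSpace 𝓘(ℝ, E') p) (f x) ⟨f y, s y⟩).2 +
    (trivializationAt E' (fun p : M' => TangentSpace 𝓘(ℝ, E') p) (f x) ⟨f y, s' y⟩).2 := by
  filter_upwards [eventually_mem_baseSet (E' := E') hf] with y hy
  exact ((trivializationAt E' (fun p : M' => TangentSpace 𝓘(ℝ, E') p) (f x)).linear ℝ hy).map_add _ _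

theorem coord_smul_eventuallyEq (h : M → ℝ) (hf : ContinuousAt f x) : ∀ᶠ y in 𝓝 x,
    (trivializationAt E' (fun p : M' => TangentSpace 𝓘(ℝ, E') p) (f x) ⟨f y, h y • s y⟩).2 =
    h y • (trivializationAt E' (fun p : M' => TangentSpace 𝓘(ℝ, E') p) (f x) ⟨f y, s y⟩).2 := by
  filter_upwards [eventually_mem_baseSet (E' := E') hf] with y hy
  exact ((trivializationAt E' (fun p : M' => TangentSpace 𝓘(ℝ, E') p) (f x)).linear ℝ hy).map_smul _ _

theorem MDiffAlong.add (hs : MDiffAlong E f s x) (hs' : MDiffAlong E f s' x) :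
    MDiffAlong E f (fun y => s y + s' y) x :=
  .of_coord hs.base ((hs.coord.add hs'.coord).congr_of_eventuallyEq
    (coord_add_eventuallyEq hs.base.continuousAt))

theorem MDiffAlong.smul {h : M → ℝ} (hh : MDifferentiableAt 𝓘(ℝ, E) 𝓘(ℝ) h x)
    (hs : MDiffAlong E f s x) : MDiffAlong E f (fun y => h y • s y) x :=
  .of_coord hs.base ((hh.smul hs.coord).congr_of_eventuallyEq
    (coord_smul_eventuallyEq h hs.base.continuousAt))

theorem MDiffAlong.congr (hs : MDiffAlong E f s x) (h : ∀ᶠ y in 𝓝 x, s' y = s y) :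
    MDiffAlong E f s' x := by
  refine MDifferentiableAt.congr_of_eventuallyEq (f := fun y => (⟨f y, s y⟩ : TangentBundle 𝓘(ℝ, E') M')) hs ?_
  filter_upwards [h] with y hy
  rw [hy]

/-- Induction principle for differentiable vector fields along `f`: they are locally combinations of
restrictions of smooth vector fields. -/
theorem MDiffAlong.induction {P : (Π x : M, TangentSpace 𝓘(ℝ, E') (f x)) → Prop}
    (comp : ∀ Y : Π p : M', TangentSpace 𝓘(ℝ, E') p, SmoothAt Y (f x) → P fun y => Y (f y))
    (add : ∀ s s', P s → P s' → P fun y => s y + s' y)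
    (smul : ∀ (h : M → ℝ) s, MDifferentiableAt 𝓘(ℝ, E) 𝓘(ℝ) h x → P s → P fun y => h y • s y)
    (congr : ∀ s s', (∀ᶠ y in 𝓝 x, s' y = s y) → P s → P s')
    (hs : MDiffAlong E f s x) : P s := by
  set t := trivializationAt E' (fun p : M' => TangentSpace 𝓘(ℝ, E') p) (f x) with ht
  have hx : f x ∈ t.baseSet := mem_baseSet_trivializationAt' (f x)
  let b := Module.finBasis ℝ E'
  -- The `e i` form the frame with constant coordinates in the trivialization at `f x`, and the `c
  -- i` are the components of `s` in it, so `s = ∑ c i • (e i ∘ f)` near `x`.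
  let e : Fin (Module.finrank ℝ E') → Π p : M', TangentSpace 𝓘(ℝ, E') p :=
    fun i => extend E' (t.symmL ℝ (f x) (b i))
  let c : Fin (Module.finrank ℝ E') → M → ℝ := fun i y => b.equivFunL (t ⟨f y, s y⟩).2 i
  have hc : ∀ i, MDifferentiableAt 𝓘(ℝ, E) 𝓘(ℝ) (c i) x := fun i =>
    MDifferentiableAt.comp x (g := fun w => b.equivFunL w i) (f := fun y => (t ⟨f y, s y⟩).2)
      (((ContinuousLinearMap.proj i).comp
        (b.equivFunL : E' →L[ℝ] Fin (Module.finrank ℝ E') → ℝ)).differentiableAt.mdifferentiableAt)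
      hs.coord
  have hsum : ∀ S : Finset (Fin (Module.finrank ℝ E')),
      P fun y => ∑ i ∈ S, c i y • e i (f y) := by
    classical
    intro S
    induction S using Finset.induction_on with
    | empty =>
      have h0 : SmoothAt (fun _ => 0 : Π p : M', TangentSpace 𝓘(ℝ, E') p) (f x) :=
        .of_forall fun p => contMDiff_zeroSection ℝ (fun p : M' => TangentSpace 𝓘(ℝ, E') p) p
      simpa using comp _ h0
    | insert i S hi ih =>
      simp only [Finset.sum_insert hi]
      exact add _ _ (smul _ _ (hc i) (comp _ (smoothAt_extend _))) ih
  refine congr _ _ ?_ (hsum Finset.univ)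
  filter_upwards [eventually_mem_baseSet (E' := E') hs.base.continuousAt] with y hy
  have h1 : ∀ i, e i (f y) = t.symmL ℝ (f y) (b i) := by
    intro i
    have h2 : (t ⟨f x, t.symmL ℝ (f x) (b i)⟩).2 = b i := by
      rw [Trivialization.symmL_apply _ hx]
      exact congrArg Prod.snd (t.apply_mk_symm hx (b i))
    rw [Trivialization.symmL_apply _ hy]
    simp only [e]
    unfold extend
    rw [← ht, h2]
  simp only [h1, ← map_smul, ← map_sum]
  have h3 : ∑ i, c i y • b i = (t ⟨f y, s y⟩).2 := b.sum_equivFun _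
  rw [h3, Trivialization.symmL_apply _ hy]
  exact (t.symm_apply_apply_mk hy (s y)).symm

end

variable [RiemannianBundle (fun x : M' => TangentSpace 𝓘(ℝ, E') x)]
  [IsContMDiffRiemannianBundle 𝓘(ℝ, E') ∞ E' (fun x : M' => TangentSpace 𝓘(ℝ, E') x)]
  {f : M → M'} {s s' : Π x : M, TangentSpace 𝓘(ℝ, E') (f x)} {x : M}

theorem covAlong_congr (h : ∀ᶠ y in 𝓝 x, s' y = s y) : covAlong E f s' x = covAlong E f s x := by
  unfold covAlong
  rw [h.self_of_nhds]
  congr 2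
  refine mvfderiv_congr ?_
  filter_upwards [h] with y hy
  rw [hy]

theorem eventually_extend_eq {p : M'} (v : TangentSpace 𝓘(ℝ, E') p) : ∀ᶠ q in 𝓝 p,
    extend E' v q = (trivializationAt E' (fun p : M' => TangentSpace 𝓘(ℝ, E') p) p).symmL ℝ q
      ((trivializationAt E' (fun p : M' => TangentSpace 𝓘(ℝ, E') p) p).continuousLinearMapAt ℝ p v) := by
  filter_upwards [(trivializationAt E' (fun p : M' => TangentSpace 𝓘(ℝ, E') p) p).open_baseSet.mem_nhds
    (mem_baseSet_trivializationAt' p)] with q hq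
  rw [Trivialization.symmL_apply _ hq,
    Trivialization.continuousLinearMapAt_apply_of_mem (R := ℝ) _ (mem_baseSet_trivializationAt' p)]
  rfl

/-- Near `p` the extension has constant coordinates, hence depends linearly on the vector. This and
its scalar analogue give linearity in `s x` of the zeroth-order term of `covAlong`. -/
theorem leviCivita_extend_add {p : M'} (v w : TangentSpace 𝓘(ℝ, E') p) :
    leviCivita E' M' (extend E' (v + w)) p
      = leviCivita E' M' (extend E' v) p + leviCivita E' M' (extend E' w) p := by
  rw [← leviCivita_add (smoothAt_extend v) (smoothAt_extend w)]
  refine leviCivita_congr ((smoothAt_extend v).add (smoothAt_extend w)) ?_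
  filter_upwards [eventually_extend_eq v, eventually_extend_eq w, eventually_extend_eq (v + w)]
    with q h1 h2 h3
  rw [h1, h2, h3, map_add, map_add]

theorem leviCivita_extend_smul {p : M'} (c : ℝ) (v : TangentSpace 𝓘(ℝ, E') p) :
    leviCivita E' M' (extend E' (c • v)) p = c • leviCivita E' M' (extend E' v) p := by
  have h := SmoothFnAt.const (E := E') c p
  have h1 : leviCivita E' M' (extend E' (c • v)) p
      = leviCivita E' M' (fun q => c • extend E' v q) p := by
    refine leviCivita_congr (SmoothAt.smul h (smoothAt_extend v)) ?_
    filter_upwards [eventually_extend_eq v, eventually_extend_eq (c • v)] with q h1 h2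
    rw [h1, h2, map_smul, map_smul]
  rw [h1]
  ext u
  rw [leviCivita_smul h (smoothAt_extend v), mvfderiv_const]
  simp

theorem covAlong_add (hs : MDiffAlong E f s x) (hs' : MDiffAlong E f s' x) :
    covAlong E f (fun y => s y + s' y) x = covAlong E f s x + covAlong E f s' x := by
  unfold covAlong
  rw [mvfderiv_congr (coord_add_eventuallyEq hs.base.continuousAt),
    mvfderiv_fun_add hs.coord hs'.coord, leviCivita_extend_add]
  ext v
  simp
  abel

theorem covAlong_smul {h : M → ℝ} (hh : MDifferentiableAt 𝓘(ℝ, E) 𝓘(ℝ) h x)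
    (hs : MDiffAlong E f s x) (v : TangentSpace 𝓘(ℝ, E) x) :
    covAlong E f (fun y => h y • s y) x v = h x • covAlong E f s x v + d% h x v • s x := by
  unfold covAlong
  rw [mvfderiv_congr (coord_smul_eventuallyEq h hs.base.continuousAt),
    mvfderiv_fun_smul hh hs.coord, leviCivita_extend_smul]
  have hx := mem_baseSet_trivializationAt' (F := E') (E := fun p : M' => TangentSpace 𝓘(ℝ, E') p) (f x)
  have h3 : (trivializationAt E' (fun p : M' => TangentSpace 𝓘(ℝ, E') p) (f x)).symmL ℝ (f x)
      (trivializationAt E' (fun p : M' => TangentSpace 𝓘(ℝ, E') p) (f x) ⟨f x, s x⟩).2 = s x := by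
    rw [Trivialization.symmL_apply _ hx]
    exact Trivialization.symm_apply_apply_mk _ hx (s x)
  simp [h3]
  abel

theorem MDiffAlong.clm_apply {J : Π x : M', TangentSpace 𝓘(ℝ, E') x →L[ℝ] TangentSpace 𝓘(ℝ, E') x}
    (hJ : IsKaehler J) (hs : MDiffAlong E f s x) : MDiffAlong E f (fun y => J (f y) (s y)) x :=
  MDifferentiableAt.clm_bundle_apply (F₁ := E') (F₂ := E')
    (E₁ := fun p : M' => TangentSpace 𝓘(ℝ, E') p) (E₂ := fun p : M' => TangentSpace 𝓘(ℝ, E') p)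
    (((hJ.smooth (f x)).mdifferentiableAt (by simp)).comp x hs.base) hs

variable [RiemannianBundle (fun x : M => TangentSpace 𝓘(ℝ, E) x)]
  [IsContMDiffRiemannianBundle 𝓘(ℝ, E) ∞ E (fun x : M => TangentSpace 𝓘(ℝ, E) x)]

/-- The covariant derivative along `f` commutes with a parallel endomorphism. -/
theorem covAlong_clm_apply {J : Π x : M', TangentSpace 𝓘(ℝ, E') x →L[ℝ] TangentSpace 𝓘(ℝ, E') x}
    (hJ : IsKaehler J) (hs : MDiffAlong E f s x) (v : TangentSpace 𝓘(ℝ, E) x) :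
    covAlong E f (fun y => J (f y) (s y)) x v = J (f x) (covAlong E f s x v) := by
  have hf := hs.base
  refine (MDiffAlong.induction (P := fun s => MDiffAlong E f s x ∧
    covAlong E f (fun y => J (f y) (s y)) x v = J (f x) (covAlong E f s x v)) ?_ ?_ ?_ ?_ hs).2
  · intro Y hY
    refine ⟨.comp hf hY.mdifferentiableAt, ?_⟩
    have hJY : SmoothAt (fun p => J p (Y p)) (f x) := hY.clm_apply hJ.smooth
    rw [covAlong_comp hf hY.mdifferentiableAt, covAlong_comp hf hJY.mdifferentiableAt,
      hJ.parallel _ _ hY.mdifferentiableAt]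
  · rintro s s' ⟨h1, h2⟩ ⟨h1', h2'⟩
    refine ⟨h1.add h1', ?_⟩
    simp only [map_add]
    rw [covAlong_add (h1.clm_apply hJ) (h1'.clm_apply hJ), covAlong_add h1 h1', add_apply, h2, h2',
      add_apply, map_add]
  · rintro h s hh ⟨h1, h2⟩
    refine ⟨h1.smul hh, ?_⟩
    simp only [map_smul]
    rw [covAlong_smul hh (h1.clm_apply hJ), covAlong_smul hh h1, h2, map_add, map_smul, map_smul]
  · rintro s s' hss ⟨h1, h2⟩
    refine ⟨h1.congr hss, ?_⟩
    rw [covAlong_congr hss, ← h2]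
    refine DFunLike.congr_fun (covAlong_congr ?_) v
    filter_upwards [hss] with y hy
    rw [hy]

theorem MDiffAlong.inner (hs : MDiffAlong E f s x) (hs' : MDiffAlong E f s' x) :
    MDifferentiableAt 𝓘(ℝ, E) 𝓘(ℝ) (fun y => (inner ℝ (s y) (s' y) : ℝ)) x :=
  MDifferentiableAt.inner_bundle (F := E') (E := fun x : M' => TangentSpace 𝓘(ℝ, E') x) hs hs'

/-- The covariant derivative along `f` is metric. -/
theorem mvfderiv_inner_along (hs : MDiffAlong E f s x) (hs' : MDiffAlong E f s' x)
    (v : TangentSpace 𝓘(ℝ, E) x) :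
    d% (fun y => (inner ℝ (s y) (s' y) : ℝ)) x v =
      inner ℝ (covAlong E f s x v) (s' x) + inner ℝ (s x) (covAlong E f s' x v) := by
  have hf := hs.base
  refine (MDiffAlong.induction (P := fun s => MDiffAlong E f s x ∧
    d% (fun y => (inner ℝ (s y) (s' y) : ℝ)) x v =
      inner ℝ (covAlong E f s x v) (s' x) + inner ℝ (s x) (covAlong E f s' x v)) ?_ ?_ ?_ ?_ hs).2
  · intro Y hY
    have hY' := MDiffAlong.comp hf hY.mdifferentiableAt
    refine ⟨hY', ?_⟩
    refine (MDiffAlong.induction (P := fun s' => MDiffAlong E f s' x ∧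
      d% (fun y => (inner ℝ (Y (f y)) (s' y) : ℝ)) x v =
      inner ℝ (covAlong E f (fun y => Y (f y)) x v) (s' x)
        + inner ℝ (Y (f x)) (covAlong E f s' x v)) ?_ ?_ ?_ ?_ hs').2
    · intro Z hZ
      refine ⟨.comp hf hZ.mdifferentiableAt, ?_⟩
      rw [covAlong_comp hf hY.mdifferentiableAt, covAlong_comp hf hZ.mdifferentiableAt,
        mvfderiv_comp_eq (h := fun p => (inner ℝ (Y p) (Z p) : ℝ))
          (hY.inner_fun hZ).mdifferentiableAt hf]
      have h := mvfderiv_inner (smoothAt_extend (mfderiv 𝓘(ℝ, E) 𝓘(ℝ, E') f x v)) hY hZ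
      simpa using h
    · rintro s s' ⟨h1, h2⟩ ⟨h1', h2'⟩
      refine ⟨h1.add h1', ?_⟩
      simp only [inner_add_right]
      rw [mvfderiv_fun_add (hY'.inner h1) (hY'.inner h1'), covAlong_add h1 h1', add_apply, h2, h2',
        add_apply, inner_add_right]
      ring
    · rintro h s hh ⟨h1, h2⟩
      refine ⟨h1.smul hh, ?_⟩
      simp only [inner_smul_right]
      rw [mvfderiv_fun_mul hh (hY'.inner h1), covAlong_smul hh h1, inner_add_right,
        inner_smul_right, inner_smul_right]
      simp [h2]
      ring
    · rintro s s' hss ⟨h1, h2⟩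
      refine ⟨h1.congr hss, ?_⟩
      rw [covAlong_congr hss, hss.self_of_nhds, ← h2]
      refine DFunLike.congr_fun (mvfderiv_congr ?_) v
      filter_upwards [hss] with y hy
      rw [hy]
  · rintro s t ⟨h1, h2⟩ ⟨h1', h2'⟩
    refine ⟨h1.add h1', ?_⟩
    simp only [inner_add_left]
    rw [mvfderiv_fun_add (h1.inner hs') (h1'.inner hs'), covAlong_add h1 h1', add_apply, h2, h2',
      add_apply, inner_add_left]
    ring
  · rintro h s hh ⟨h1, h2⟩
    refine ⟨h1.smul hh, ?_⟩
    simp only [real_inner_smul_left]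
    rw [mvfderiv_fun_mul hh (h1.inner hs'), covAlong_smul hh h1, inner_add_left,
      real_inner_smul_left, real_inner_smul_left]
    simp [h2]
    ring
  · rintro s t hss ⟨h1, h2⟩
    refine ⟨h1.congr hss, ?_⟩
    rw [covAlong_congr hss, hss.self_of_nhds, ← h2]
    refine DFunLike.congr_fun (mvfderiv_congr ?_) v
    filter_upwards [hss] with y hy
    rw [hy]

theorem MDiffAlong.mfderiv (hf : ContMDiffAt 𝓘(ℝ, E) 𝓘(ℝ, E') ∞ f x)
    {X : Π x : M, TangentSpace 𝓘(ℝ, E) x} (hX : SmoothAt X x) :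
    MDiffAlong E f (fun y => mfderiv 𝓘(ℝ, E) 𝓘(ℝ, E') f y (X y)) x :=
  (contMDiffAt_mfderiv_apply hf hX.contMDiffAt).mdifferentiableAt (by simp)

theorem coord_eq_mvfderiv {p q : M'} (hq : q ∈ (chartAt E' p).source)
    (w : TangentSpace 𝓘(ℝ, E') q) :
    (trivializationAt E' (fun p : M' => TangentSpace 𝓘(ℝ, E') p) p ⟨q, w⟩).2 =
      d% (extChartAt 𝓘(ℝ, E') p) q w := by
  have h1 := TangentBundle.continuousLinearMapAt_trivializationAt (I := 𝓘(ℝ, E')) hq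
  have hb : q ∈ (trivializationAt E' (fun p : M' => TangentSpace 𝓘(ℝ, E') p) p).baseSet := by
    simpa using hq
  rw [← Trivialization.continuousLinearMapAt_apply_of_mem (R := ℝ) _ hb, h1]
  rfl

/-- Coordinate vector fields commute. -/
theorem mlieBracket_extend {p : M'} (v w : TangentSpace 𝓘(ℝ, E') p) :
    mlieBracket 𝓘(ℝ, E') (extend E' v) (extend E' w) p = 0 := by
  set t := trivializationAt E' (fun p : M' => TangentSpace 𝓘(ℝ, E') p) p with ht
  have hsrc : ∀ᶠ q in 𝓝 p, q ∈ (chartAt E' p).source :=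
    (chartAt E' p).open_source.mem_nhds (mem_chart_source E' p)
  have hh : SmoothFnAt (E := E') (extChartAt 𝓘(ℝ, E') p : M' → E') p := by
    filter_upwards [hsrc] with q hq
    exact contMDiffAt_extChartAt' hq
  have hconst : ∀ u : TangentSpace 𝓘(ℝ, E') p, ∀ᶠ q in 𝓝 p,
      d% (extChartAt 𝓘(ℝ, E') p) q (extend E' u q) = (t ⟨p, u⟩).2 := by
    intro u
    filter_upwards [hsrc] with q hq
    rw [← coord_eq_mvfderiv hq]
    have hb : q ∈ t.baseSet := by simpa [t] using hq
    have h := congrArg Prod.snd (t.apply_mk_symm hb (t ⟨p, u⟩).2)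
    exact h
  -- Both fields differentiate the chart map to a constant, so the chart differential kills their
  -- bracket; that differential is injective at `p`.
  have key := mvfderiv_mlieBracket hh (smoothAt_extend v) (smoothAt_extend w)
  rw [mvfderiv_congr (hconst v), mvfderiv_congr (hconst w), mvfderiv_const, mvfderiv_const,
    ← coord_eq_mvfderiv (mem_chart_source E' p)] at key
  have hb : p ∈ t.baseSet := mem_baseSet_trivializationAt' p
  have h2 := t.symm_apply_apply_mk hb (mlieBracket 𝓘(ℝ, E') (extend E' v) (extend E' w) p)
  rw [← key, ← Trivialization.symmL_apply (R := ℝ) _ hb] at h2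
  simpa using h2.symm

/-- The covariant derivative along `f` is torsion free. -/
theorem covAlong_mfderiv_sub (hf : ∀ᶠ y in 𝓝 x, ContMDiffAt 𝓘(ℝ, E) 𝓘(ℝ, E') ∞ f y)
    {X Y : Π x : M, TangentSpace 𝓘(ℝ, E) x} (hX : SmoothAt X x) (hY : SmoothAt Y x) :
    covAlong E f (fun y => mfderiv 𝓘(ℝ, E) 𝓘(ℝ, E') f y (Y y)) x (X x)
      - covAlong E f (fun y => mfderiv 𝓘(ℝ, E) 𝓘(ℝ, E') f y (X y)) x (Y x) =
    mfderiv 𝓘(ℝ, E) 𝓘(ℝ, E') f x (mlieBracket 𝓘(ℝ, E) X Y x) := by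
  set t := trivializationAt E' (fun p : M' => TangentSpace 𝓘(ℝ, E') p) (f x) with ht
  have hfx := hf.self_of_nhds
  have hsrc : ∀ᶠ y in 𝓝 x, f y ∈ (chartAt E' (f x)).source :=
    hfx.continuousAt ((chartAt E' (f x)).open_source.mem_nhds (mem_chart_source E' (f x)))
  have hh : SmoothFnAt (E := E) (fun y => extChartAt 𝓘(ℝ, E') (f x) (f y)) x := by
    filter_upwards [hsrc, hf] with y hy hfy
    exact (contMDiffAt_extChartAt' hy).comp y hfy
  have hcoord : ∀ Z : Π x : M, TangentSpace 𝓘(ℝ, E) x, ∀ᶠ y in 𝓝 x,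
      (t ⟨f y, mfderiv 𝓘(ℝ, E) 𝓘(ℝ, E') f y (Z y)⟩).2 =
      d% (fun y => extChartAt 𝓘(ℝ, E') (f x) (f y)) y (Z y) := by
    intro Z
    filter_upwards [hsrc, hf] with y hy hfy
    rw [coord_eq_mvfderiv hy]
    exact (mvfderiv_comp_eq (h := extChartAt 𝓘(ℝ, E') (f x)) (f := f)
      ((contMDiffAt_extChartAt' (n := ∞) hy).mdifferentiableAt (by simp))
      (hfy.mdifferentiableAt (by simp)) (Z y)).symm
  -- The coordinates of `df(Y)` are the derivatives along `Y` of the chart composed with `f`, so the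
  -- first-order parts of the two sides agree by the commutator formula.
  have key := mvfderiv_mlieBracket hh hX hY
  rw [← mvfderiv_congr (hcoord X), ← mvfderiv_congr (hcoord Y),
    ← (hcoord (mlieBracket 𝓘(ℝ, E) X Y)).self_of_nhds] at key
  have hb : f x ∈ t.baseSet := mem_baseSet_trivializationAt' (f x)
  have h2 := t.symm_apply_apply_mk hb (mfderiv 𝓘(ℝ, E) 𝓘(ℝ, E') f x (mlieBracket 𝓘(ℝ, E) X Y x))
  rw [← key, ← Trivialization.symmL_apply (R := ℝ) _ hb, map_sub] at h2
  -- The remaining Christoffel terms cancel: they are symmetric because coordinate fields commute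
  -- and `∇'` has no torsion.
  have h3 := mlieBracket_eq_leviCivita
    (smoothAt_extend (mfderiv 𝓘(ℝ, E) 𝓘(ℝ, E') f x (X x)))
    (smoothAt_extend (mfderiv 𝓘(ℝ, E) 𝓘(ℝ, E') f x (Y x)))
  rw [mlieBracket_extend] at h3
  simp only [extend_apply_self] at h3
  rw [← h2]
  unfold covAlong
  rw [add_apply, add_apply]
  simp only [ContinuousLinearMap.comp_apply]
  rw [add_sub_add_comm, ← h3, add_zero]

/-- The tangential part of the ambient covariant derivative is the Levi-Civita connection of the
induced metric. -/
theorem inner_covAlong_mfderiv (hf : ContMDiff 𝓘(ℝ, E) 𝓘(ℝ, E') ∞ f)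
    (hiso : ∀ x u v, (inner ℝ (mfderiv 𝓘(ℝ, E) 𝓘(ℝ, E') f x u)
      (mfderiv 𝓘(ℝ, E) 𝓘(ℝ, E') f x v) : ℝ) = inner ℝ u v)
    {X Y Z : Π x : M, TangentSpace 𝓘(ℝ, E) x} (hX : SmoothAt X x) (hY : SmoothAt Y x)
    (hZ : SmoothAt Z x) :
    (inner ℝ (covAlong E f (fun y => mfderiv 𝓘(ℝ, E) 𝓘(ℝ, E') f y (Y y)) x (X x))
      (mfderiv 𝓘(ℝ, E) 𝓘(ℝ, E') f x (Z x)) : ℝ) = inner ℝ (leviCivita E M Y x (X x)) (Z x) := by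
  have hfe : ∀ᶠ y in 𝓝 x, ContMDiffAt 𝓘(ℝ, E) 𝓘(ℝ, E') ∞ f y := .of_forall fun y => hf y
  rw [inner_leviCivita hY.mdifferentiableAt hX.mdifferentiableAt hZ.mdifferentiableAt, koszul]
  -- Koszul's expression for the induced metric is moved to the ambient bundle; since the connection
  -- along `f` is metric and torsion free, it collapses to a single term.
  simp only [← hiso, ← covAlong_mfderiv_sub hfe hX hY, ← covAlong_mfderiv_sub hfe hX hZ,
    ← covAlong_mfderiv_sub hfe hY hZ]
  rw [mvfderiv_inner_along (.mfderiv (hf x) hY) (.mfderiv (hf x) hZ),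
    mvfderiv_inner_along (.mfderiv (hf x) hZ) (.mfderiv (hf x) hX),
    mvfderiv_inner_along (.mfderiv (hf x) hX) (.mfderiv (hf x) hY)]
  simp only [inner_sub_left]
  have c := fun u v : TangentSpace 𝓘(ℝ, E') (f x) => real_inner_comm u v
  rw [c (covAlong E f (fun y => mfderiv 𝓘(ℝ, E) 𝓘(ℝ, E') f y (X y)) x (Y x)),
    c (covAlong E f (fun y => mfderiv 𝓘(ℝ, E) 𝓘(ℝ, E') f y (Z y)) x (X x)),
    c (covAlong E f (fun y => mfderiv 𝓘(ℝ, E) 𝓘(ℝ, E') f y (Y y)) x (Z x))]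
  ring

end Along

/-! ### Smoothness criteria for endomorphism fields and one-forms -/

section HomBundle

variable {E : Type*} [NormedAddCommGroup E] [NormedSpace ℝ E] [FiniteDimensional ℝ E]
  {M : Type*} [TopologicalSpace M] [ChartedSpace E M] [IsManifold 𝓘(ℝ, E) ∞ M]

/-- Identifies the columns of a bundle map in the trivialization with its values on the fields
`extend`, so smoothness in coordinates can be tested on smooth vector fields. -/
theorem eventually_symmL_eq_extend (x : M) (v : E) : ∀ᶠ y in 𝓝 x,
    (trivializationAt E (fun p : M => TangentSpace 𝓘(ℝ, E) p) x).symmL ℝ y v =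
      extend E ((trivializationAt E (fun p : M => TangentSpace 𝓘(ℝ, E) p) x).symmL ℝ x v) y := by
  set t := trivializationAt E (fun p : M => TangentSpace 𝓘(ℝ, E) p) x with ht
  have hx : x ∈ t.baseSet := mem_baseSet_trivializationAt' x
  filter_upwards [t.open_baseSet.mem_nhds hx] with y hy
  have h1 : (t ⟨x, t.symmL ℝ x v⟩).2 = v := by
    rw [Trivialization.symmL_apply _ hx]
    exact congrArg Prod.snd (t.apply_mk_symm hx v)
  rw [Trivialization.symmL_apply _ hy]
  exact (congrArg (t.symm y) h1).symm

/-- An endomorphism field is smooth if it maps smooth vector fields to smooth vector fields. -/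
theorem contMDiffAt_endomorphism
    {A : Π x : M, TangentSpace 𝓘(ℝ, E) x →L[ℝ] TangentSpace 𝓘(ℝ, E) x} {x : M}
    (hA : ∀ Y : Π x : M, TangentSpace 𝓘(ℝ, E) x, SmoothAt Y x →
      ContMDiffAt 𝓘(ℝ, E) 𝓘(ℝ, E).tangent ∞ (T% (fun y => A y (Y y))) x) :
    ContMDiffAt 𝓘(ℝ, E) (𝓘(ℝ, E).prod 𝓘(ℝ, E →L[ℝ] E)) ∞
      (fun x => TotalSpace.mk' (E →L[ℝ] E)
        (E := fun x : M => TangentSpace 𝓘(ℝ, E) x →L[ℝ] TangentSpace 𝓘(ℝ, E) x) x (A x)) x := by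
  rw [contMDiffAt_hom_bundle]
  refine ⟨contMDiffAt_id, contMDiffAt_clm_of_apply fun v => ?_⟩
  have h := hA _ (smoothAt_extend
    ((trivializationAt E (fun p : M => TangentSpace 𝓘(ℝ, E) p) x).symmL ℝ x v))
  rw [contMDiffAt_section] at h
  refine h.congr_of_eventuallyEq ?_
  filter_upwards [eventually_symmL_eq_extend x v,
    (trivializationAt E (fun p : M => TangentSpace 𝓘(ℝ, E) p) x).open_baseSet.mem_nhds
      (mem_baseSet_trivializationAt' x)] with y h1 h2
  rw [← h1, ← Trivialization.continuousLinearMapAt_apply_of_mem (R := ℝ) _ h2]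
  rfl

/-- A one-form is smooth if its values on smooth vector fields are smooth. -/
theorem contMDiffAt_oneForm {A : Π x : M, TangentSpace 𝓘(ℝ, E) x →L[ℝ] ℝ} {x : M}
    (hA : ∀ Y : Π x : M, TangentSpace 𝓘(ℝ, E) x, SmoothAt Y x →
      ContMDiffAt 𝓘(ℝ, E) 𝓘(ℝ) ∞ (fun y => A y (Y y)) x) :
    ContMDiffAt 𝓘(ℝ, E) (𝓘(ℝ, E).prod 𝓘(ℝ, E →L[ℝ] ℝ)) ∞
      (fun x => TotalSpace.mk' (E →L[ℝ] ℝ)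
        (E := fun x : M => TangentSpace 𝓘(ℝ, E) x →L[ℝ] ℝ) x (A x)) x := by
  rw [contMDiffAt_hom_bundle (E₂ := Bundle.Trivial M ℝ)]
  refine ⟨contMDiffAt_id, contMDiffAt_clm_of_apply fun v => ?_⟩
  have h := hA _ (smoothAt_extend
    ((trivializationAt E (fun p : M => TangentSpace 𝓘(ℝ, E) p) x).symmL ℝ x v))
  refine h.congr_of_eventuallyEq ?_
  filter_upwards [eventually_symmL_eq_extend x v] with y h1
  rw [← h1]
  simp [ContinuousLinearMap.inCoordinates]

end HomBundle

/-! ### Umbilical hypersurfaces of Kähler manifolds are α-Sasakian -/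

section Hypersurface

variable {E : Type*} [NormedAddCommGroup E] [NormedSpace ℝ E] [FiniteDimensional ℝ E]
  {M : Type*} [TopologicalSpace M] [ChartedSpace E M] [IsManifold 𝓘(ℝ, E) ∞ M]
  [RiemannianBundle (fun x : M => TangentSpace 𝓘(ℝ, E) x)]
  [IsContMDiffRiemannianBundle 𝓘(ℝ, E) ∞ E (fun x : M => TangentSpace 𝓘(ℝ, E) x)]

/-- An almost contact metric structure `(φ, ξ, η, g)` is `α`-Sasakian if
`(∇_v φ) Y = α (g(v, Y) ξ - η(Y) v)`; then `∇_v ξ = - α φ v`. -/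
structure AlmostContact.IsAlphaSasakian (S : AlmostContact E M) (α : M → ℝ) : Prop
    extends S.IsMetric where
  η_eq : ∀ x v, S.η x v = inner ℝ (S.ξ x) v
  φ_skew : ∀ x u v, (inner ℝ (S.φ x u) v : ℝ) = -inner ℝ u (S.φ x v)
  φ_ξ : ∀ x, S.φ x (S.ξ x) = 0
  smooth_α : ContMDiff 𝓘(ℝ, E) 𝓘(ℝ) ∞ α
  leviCivita_ξ : ∀ x v, leviCivita E M S.ξ x v = -α x • S.φ x v
  leviCivita_φ : ∀ x (Y : Π x : M, TangentSpace 𝓘(ℝ, E) x) v, SmoothAt Y x →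
    leviCivita E M (fun y => S.φ y (Y y)) x v = S.φ x (leviCivita E M Y x v)
      + α x • ((inner ℝ v (Y x) : ℝ) • S.ξ x - S.η x (Y x) • v)

variable {E' : Type*} [NormedAddCommGroup E'] [NormedSpace ℝ E'] [FiniteDimensional ℝ E']
  {M' : Type*} [TopologicalSpace M'] [ChartedSpace E' M'] [IsManifold 𝓘(ℝ, E') ∞ M']
  [RiemannianBundle (fun x : M' => TangentSpace 𝓘(ℝ, E') x)]
  [IsContMDiffRiemannianBundle 𝓘(ℝ, E') ∞ E' (fun x : M' => TangentSpace 𝓘(ℝ, E') x)]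
  {J : Π x : M', TangentSpace 𝓘(ℝ, E') x →L[ℝ] TangentSpace 𝓘(ℝ, E') x}
  {f : M → M'} {N : Π x : M, TangentSpace 𝓘(ℝ, E') (f x)} {β : M → ℝ}

theorem inner_tangential (x : M) (w : TangentSpace 𝓘(ℝ, E') (f x)) (u : TangentSpace 𝓘(ℝ, E) x) :
    (inner ℝ (tangential E f x w) u : ℝ) = inner ℝ w (mfderiv 𝓘(ℝ, E) 𝓘(ℝ, E') f x u) := by
  rw [tangential, ContinuousLinearMap.adjoint_inner_left]

theorem IsUnitNormal.tangential_mfderiv (hN : IsUnitNormal E f N) (x : M)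
    (u : TangentSpace 𝓘(ℝ, E) x) : tangential E f x (mfderiv 𝓘(ℝ, E) 𝓘(ℝ, E') f x u) = u :=
  ext_inner_right ℝ fun w => by rw [inner_tangential, hN.isometry]

theorem IsUnitNormal.tangential_normal (hN : IsUnitNormal E f N) (x : M) :
    tangential E f x (N x) = 0 :=
  ext_inner_right ℝ fun w => by rw [inner_tangential, hN.normal, inner_zero_left]

theorem IsUnitNormal.inner_self (hN : IsUnitNormal E f N) (x : M) :
    (inner ℝ (N x) (N x) : ℝ) = 1 := by
  rw [real_inner_self_eq_norm_sq, hN.unit x]; norm_num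

/-- In codimension one a dimension count shows that the image of `df` is all of `N^⊥`, and the
adjoint of `df` inverts `df` there. -/
theorem IsUnitNormal.mfderiv_tangential (hN : IsUnitNormal E f N)
    (hdim : Module.finrank ℝ E' = Module.finrank ℝ E + 1) (x : M)
    (w : TangentSpace 𝓘(ℝ, E') (f x)) (hw : (inner ℝ (N x) w : ℝ) = 0) :
    mfderiv 𝓘(ℝ, E) 𝓘(ℝ, E') f x (tangential E f x w) = w := by
  set L := mfderiv 𝓘(ℝ, E) 𝓘(ℝ, E') f x with hL
  have hinj : Function.Injective L :=
    Function.LeftInverse.injective (g := tangential E f x) (hN.tangential_mfderiv x)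
  have hN0 : N x ≠ 0 := fun h => by simpa [h] using hN.unit x
  have hrange : LinearMap.range (L : TangentSpace 𝓘(ℝ, E) x →ₗ[ℝ] TangentSpace 𝓘(ℝ, E') (f x))
      = (ℝ ∙ N x)ᗮ := by
    apply Submodule.eq_of_le_of_finrank_eq
    · rintro _ ⟨u, rfl⟩
      rw [Submodule.mem_orthogonal_singleton_iff_inner_right]
      exact hN.normal x u
    · rw [LinearMap.finrank_range_of_inj hinj]
      have h1 := Submodule.finrank_add_finrank_orthogonal (ℝ ∙ N x)
      rw [finrank_span_singleton hN0] at h1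
      have h2 : Module.finrank ℝ (TangentSpace 𝓘(ℝ, E') (f x)) = Module.finrank ℝ E' := rfl
      have h3 : Module.finrank ℝ (TangentSpace 𝓘(ℝ, E) x) = Module.finrank ℝ E := rfl
      omega
  rw [← Submodule.mem_orthogonal_singleton_iff_inner_right, ← hrange] at hw
  obtain ⟨u, rfl⟩ := hw
  exact congrArg L (hN.tangential_mfderiv x u)

theorem IsKaehler.inner_skew (hJ : IsKaehler J) {p : M'} (u v : TangentSpace 𝓘(ℝ, E') p) :
    (inner ℝ (J p u) v : ℝ) = -inner ℝ u (J p v) := by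
  rw [← hJ.inner_map_map p u (J p v), hJ.sq, inner_neg_right, neg_neg]

theorem IsUnitNormal.mdiffAlong (hN : IsUnitNormal E f N) (x : M) : MDiffAlong E f N x :=
  (hN.smooth_normal x).mdifferentiableAt (by simp)

/-- Differentiating `g(N,N) = 1` shows that the derivative of `N` has no normal component, so it is
determined by its tangential part, which is the Weingarten operator up to sign. -/
theorem IsUnitNormal.covAlong_normal (hN : IsUnitNormal E f N)
    (hβ : IsTotallyUmbilical E f N β)
    (hdim : Module.finrank ℝ E' = Module.finrank ℝ E + 1) (x : M) (v : TangentSpace 𝓘(ℝ, E) x) :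
    covAlong E f N x v = -β x • mfderiv 𝓘(ℝ, E) 𝓘(ℝ, E') f x v := by
  have h1 := hβ.2 x v
  have h2 : tangential E f x (covAlong E f N x v) = -β x • v := by
    rw [neg_smul, ← h1]
    simp [weingarten]
  have h3 := mvfderiv_inner_along (hN.mdiffAlong x) (hN.mdiffAlong x) v
  simp only [hN.inner_self, mvfderiv_const] at h3
  rw [real_inner_comm, zero_apply] at h3
  rw [← hN.mfderiv_tangential hdim x (covAlong E f N x v) (by linarith), h2, map_smul]

theorem inner_φ (x : M) (u v : TangentSpace 𝓘(ℝ, E) x) :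
    (inner ℝ ((inducedAlmostContact E J f N).φ x u) v : ℝ) =
      inner ℝ (J (f x) (mfderiv 𝓘(ℝ, E) 𝓘(ℝ, E') f x u)) (mfderiv 𝓘(ℝ, E) 𝓘(ℝ, E') f x v) := by
  rw [← inner_tangential]
  rfl

theorem induced_φ_skew (hJ : IsKaehler J)
    (x : M) (u v : TangentSpace 𝓘(ℝ, E) x) :
    (inner ℝ ((inducedAlmostContact E J f N).φ x u) v : ℝ) =
      -inner ℝ u ((inducedAlmostContact E J f N).φ x v) := by
  rw [inner_φ, hJ.inner_skew, real_inner_comm, real_inner_comm _ u, inner_φ]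

theorem inner_ξ (x : M) (v : TangentSpace 𝓘(ℝ, E) x) :
    (inner ℝ ((inducedAlmostContact E J f N).ξ x) v : ℝ) =
      inner ℝ (-J (f x) (N x)) (mfderiv 𝓘(ℝ, E) 𝓘(ℝ, E') f x v) := by
  rw [← inner_tangential]
  rfl

theorem induced_η_eq (hJ : IsKaehler J)
    (x : M) (v : TangentSpace 𝓘(ℝ, E) x) :
    (inducedAlmostContact E J f N).η x v = inner ℝ ((inducedAlmostContact E J f N).ξ x) v := by
  rw [inner_ξ, inner_neg_left, hJ.inner_skew, neg_neg]
  rfl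

theorem contMDiffAt_J_mfderiv (hJ : IsKaehler J) (hN : IsUnitNormal E f N)
    {x : M} {X : Π x : M, TangentSpace 𝓘(ℝ, E) x} (hX : SmoothAt X x) :
    ContMDiffAt 𝓘(ℝ, E) 𝓘(ℝ, E').tangent ∞ (fun y => (⟨f y, J (f y)
      (mfderiv 𝓘(ℝ, E) 𝓘(ℝ, E') f y (X y))⟩ : TangentBundle 𝓘(ℝ, E') M')) x :=
  ContMDiffAt.clm_bundle_apply (F₁ := E') (F₂ := E')
    (E₁ := fun p : M' => TangentSpace 𝓘(ℝ, E') p) (E₂ := fun p : M' => TangentSpace 𝓘(ℝ, E') p)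
    ((hJ.smooth (f x)).comp x (hN.smooth x)) (contMDiffAt_mfderiv_apply (hN.smooth x) hX.contMDiffAt)

/-- The algebraic axioms are components of `J² = -1` and of the orthogonality of `J` in the
splitting `df(TM) ⊕ ℝN`; smoothness is tested on vector fields. -/
theorem inducedAlmostContact_isMetric (hJ : IsKaehler J) (hN : IsUnitNormal E f N)
    (hdim : Module.finrank ℝ E' = Module.finrank ℝ E + 1) :
    (inducedAlmostContact E J f N).IsMetric where
  smooth_φ x := by
    refine contMDiffAt_endomorphism fun Y hY => contMDiffAt_of_inner fun Z hZ => ?_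
    simp only [inner_φ]
    exact ContMDiffAt.inner_bundle (F := E') (E := fun x : M' => TangentSpace 𝓘(ℝ, E') x)
      (contMDiffAt_J_mfderiv hJ hN hY) (contMDiffAt_mfderiv_apply (hN.smooth x) hZ.contMDiffAt)
  smooth_ξ x := by
    refine contMDiffAt_of_inner fun Z hZ => ?_
    simp only [← induced_η_eq hJ]
    exact ContMDiffAt.inner_bundle (F := E') (E := fun x : M' => TangentSpace 𝓘(ℝ, E') x)
      (hN.smooth_normal x) (contMDiffAt_J_mfderiv hJ hN hZ)
  smooth_η x := by
    refine contMDiffAt_oneForm fun Y hY => ?_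
    exact ContMDiffAt.inner_bundle (F := E') (E := fun x : M' => TangentSpace 𝓘(ℝ, E') x)
      (hN.smooth_normal x) (contMDiffAt_J_mfderiv hJ hN hY)
  φ_sq x v := by
    obtain ⟨h1, h2⟩ := inducedAlmostContact_decomposition hJ hN hdim x
    have h3 := congrArg (fun w => tangential E f x (J (f x) w)) (h2 v)
    simp only [hJ.sq, map_add, map_smul, map_neg, hN.tangential_mfderiv] at h3
    change _ = (inducedAlmostContact E J f N).φ x ((inducedAlmostContact E J f N).φ x v) + _ at h3
    have h4 : (inducedAlmostContact E J f N).ξ x = -tangential E f x (J (f x) (N x)) := map_neg _ _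
    rw [h3, h4]
    module
  η_ξ x := by
    rw [induced_η_eq hJ, inner_ξ, (inducedAlmostContact_decomposition hJ hN hdim x).1,
      inner_neg_neg, hJ.inner_map_map, hN.inner_self]
  inner_φ_φ x u v := by
    have h2 := (inducedAlmostContact_decomposition hJ hN hdim x).2
    have h3 := hJ.inner_map_map (f x) (mfderiv 𝓘(ℝ, E) 𝓘(ℝ, E') f x u)
      (mfderiv 𝓘(ℝ, E) 𝓘(ℝ, E') f x v)
    rw [h2, h2] at h3
    simp only [inner_add_left, inner_add_right, inner_smul_left, inner_smul_right, hN.isometry,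
      hN.normal, hN.inner_self, real_inner_comm (N x) (mfderiv 𝓘(ℝ, E) 𝓘(ℝ, E') f x _)] at h3
    simp at h3
    linarith

/-- A totally umbilical hypersurface of a Kähler manifold is `α`-Sasakian with `α = -β`. -/
theorem inducedAlmostContact_isAlphaSasakian (hJ : IsKaehler J) (hN : IsUnitNormal E f N)
    (hβ : IsTotallyUmbilical E f N β)
    (hdim : Module.finrank ℝ E' = Module.finrank ℝ E + 1) :
    (inducedAlmostContact E J f N).IsAlphaSasakian (fun x => -β x) where
  toIsMetric := inducedAlmostContact_isMetric hJ hN hdim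
  η_eq := induced_η_eq hJ
  φ_skew := induced_φ_skew hJ
  φ_ξ x := by
    have h1 := (inducedAlmostContact_decomposition hJ hN hdim x).1
    change tangential E f x (J (f x) (mfderiv 𝓘(ℝ, E) 𝓘(ℝ, E') f x _)) = 0
    rw [h1, map_neg, hJ.sq, neg_neg, hN.tangential_normal]
  smooth_α := hβ.1.neg
  leviCivita_ξ x v := by
    set S := inducedAlmostContact E J f N with hS
    have hmet := inducedAlmostContact_isMetric hJ hN hdim
    have hξ : SmoothAt S.ξ x := .of_forall fun y => hmet.smooth_ξ y
    refine ext_inner_right ℝ fun w => ?_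
    have h1 := inner_covAlong_mfderiv hN.smooth hN.isometry (smoothAt_extend v) hξ
      (smoothAt_extend w)
    simp only [extend_apply_self] at h1
    have h2 : (fun y => mfderiv 𝓘(ℝ, E) 𝓘(ℝ, E') f y (S.ξ y))
        = fun y => J (f y) ((-1 : ℝ) • N y) := by
      funext y
      rw [(inducedAlmostContact_decomposition hJ hN hdim y).1]
      simp
    have hc : MDifferentiableAt 𝓘(ℝ, E) 𝓘(ℝ) (fun _ : M => (-1 : ℝ)) x := mdifferentiableAt_const
    -- The derivative of `df(ξ) = -JN` is `-J(-β df(v)) = β J df(v)`, with tangential part `βφv`.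
    rw [← h1, h2, covAlong_clm_apply hJ ((hN.mdiffAlong x).smul hc),
      covAlong_smul hc (hN.mdiffAlong x), mvfderiv_const, hN.covAlong_normal hβ hdim]
    simp [inner_smul_left, inner_φ, hS]
  leviCivita_φ x Y v hY := by
    set S := inducedAlmostContact E J f N with hS
    have hmet : S.IsMetric := inducedAlmostContact_isMetric hJ hN hdim
    have hξ : SmoothAt S.ξ x := .of_forall fun y => hmet.smooth_ξ y
    have hφY : SmoothAt (fun y => S.φ y (Y y)) x := hY.clm_apply hmet.smooth_φ
    have hηY : SmoothFnAt (E := E) (fun y => -S.η y (Y y)) x := by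
      simp only [hS, induced_η_eq hJ]
      filter_upwards [hξ.inner_fun hY] with y hy using hy.neg
    refine ext_inner_right ℝ fun w => ?_
    have h1 := inner_covAlong_mfderiv hN.smooth hN.isometry (smoothAt_extend v) hφY
      (smoothAt_extend w)
    have h2 := inner_covAlong_mfderiv hN.smooth hN.isometry (smoothAt_extend v) hY
      (smoothAt_extend (S.φ x w))
    simp only [extend_apply_self] at h1 h2
    have dec := fun y => (inducedAlmostContact_decomposition hJ hN hdim y).2
    have h3 : (fun y => mfderiv 𝓘(ℝ, E) 𝓘(ℝ, E') f y (S.φ y (Y y)))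
        = fun y => J (f y) (mfderiv 𝓘(ℝ, E) 𝓘(ℝ, E') f y (Y y)) + (-S.η y (Y y)) • N y := by
      funext y
      rw [dec]
      simp [hS]
    have hdY := MDiffAlong.mfderiv (hN.smooth x) hY
    -- Differentiating `g(df(Y), N) = 0` shows that the normal part of the derivative of `df(Y)` is
    -- `β g(v,Y)`, the second fundamental form; this produces the `ξ` term.
    have h4 := mvfderiv_inner_along hdY (hN.mdiffAlong x) v
    simp only [fun y => real_inner_comm (N y) (mfderiv 𝓘(ℝ, E) 𝓘(ℝ, E') f y (Y y)),
      hN.normal, mvfderiv_const, zero_apply, hN.covAlong_normal hβ hdim, inner_smul_right,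
      hN.isometry] at h4
    -- The derivative of `J df(Y) - η(Y)N` is paired with `df(w)`. The derivative of `η(Y)`
    -- disappears since it multiplies `N`, and `J` is then moved onto `df(w)` by skewness.
    rw [← h1, h3, covAlong_add (hdY.clm_apply hJ) ((hN.mdiffAlong x).smul hηY.mdifferentiableAt),
      add_apply, covAlong_clm_apply hJ hdY, covAlong_smul hηY.mdifferentiableAt (hN.mdiffAlong x),
      hN.covAlong_normal hβ hdim]
    simp only [inner_add_left, real_inner_smul_left, hN.normal, hN.isometry, inner_sub_left,
      induced_φ_skew hJ, hS]
    rw [hJ.inner_skew, dec x w, inner_add_right, inner_smul_right, h2, ← induced_η_eq hJ]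
    rw [real_inner_comm (Y x) v]
    linear_combination (inducedAlmostContact E J f N).η x w * h4

end Hypersurface

/-! ### Curvature of α-Sasakian structures and the identities (G1)–(G3) -/

namespace AlmostContact

variable {E : Type*} [NormedAddCommGroup E] [NormedSpace ℝ E] [FiniteDimensional ℝ E]
  {M : Type*} [TopologicalSpace M] [ChartedSpace E M] [IsManifold 𝓘(ℝ, E) ∞ M]
  [RiemannianBundle (fun x : M => TangentSpace 𝓘(ℝ, E) x)]
  [IsContMDiffRiemannianBundle 𝓘(ℝ, E) ∞ E (fun x : M => TangentSpace 𝓘(ℝ, E) x)]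
  {S : AlmostContact E M} {α : M → ℝ} {x : M} {X Y Z : Π x : M, TangentSpace 𝓘(ℝ, E) x}

theorem IsMetric.smoothAt_ξ (hS : S.IsMetric) (x : M) : SmoothAt S.ξ x :=
  .of_forall fun y => hS.smooth_ξ y

theorem IsMetric.smoothAt_φ (hS : S.IsMetric) (hX : SmoothAt X x) : SmoothAt (S.φField X) x :=
  hX.clm_apply hS.smooth_φ

/-- The curvature of an `α`-Sasakian manifold in the direction of `ξ`. -/
theorem IsAlphaSasakian.curvature_ξ (hS : S.IsAlphaSasakian α) (hX : SmoothAt X x)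
    (hY : SmoothAt Y x) :
    curvature X Y S.ξ x = d% α x (Y x) • S.φ x (X x) - d% α x (X x) • S.φ x (Y x)
      + α x ^ 2 • (S.η x (Y x) • X x - S.η x (X x) • Y x) := by
  have hα : SmoothFnAt (E := E) (fun y => -α y) x := .of_forall fun y => (hS.smooth_α y).neg
  have hdα : ∀ v, d% (fun y => -α y) x v = -d% α x v := fun v => by
    rw [← neg_apply, ← mvfderiv_neg]
    rfl
  have aux : ∀ {X Y : Π x : M, TangentSpace 𝓘(ℝ, E) x}, SmoothAt X x → SmoothAt Y x →
      leviCivita E M (fun y => leviCivita E M S.ξ y (Y y)) x (X x) =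
        -α x • (S.φ x (leviCivita E M Y x (X x))
          + α x • ((inner ℝ (X x) (Y x) : ℝ) • S.ξ x - S.η x (Y x) • X x))
        - d% α x (X x) • S.φ x (Y x) := by
    intro X Y hX hY
    simp only [hS.leviCivita_ξ]
    have hφY : SmoothAt (fun y => S.φ y (Y y)) x := hS.toIsMetric.smoothAt_φ hY
    rw [leviCivita_smul hα hφY, hdα, hS.leviCivita_φ _ _ _ hY]
    module
  -- The terms in `g(X,Y)ξ` cancel by symmetry, and those in `φ(∇_X Y)` and `φ(∇_Y X)` cancel
  -- against the bracket term.
  rw [curvature, aux hX hY, aux hY hX, hS.leviCivita_ξ, mlieBracket_eq_leviCivita hX hY, map_sub,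
    real_inner_comm (X x) (Y x)]
  module

/-- An `α`-Sasakian manifold satisfying (G3) has `α = ±1`. -/
theorem IsAlphaSasakian.sq_eq_one (hS : S.IsAlphaSasakian α) (hG3 : S.G3)
    (hdim : 1 < Module.finrank ℝ E) (x : M) : α x ^ 2 = 1 := by
  obtain ⟨v, hv, hv0⟩ : ∃ v : TangentSpace 𝓘(ℝ, E) x, (inner ℝ (S.ξ x) v : ℝ) = 0 ∧ v ≠ 0 := by
    have h1 := Submodule.finrank_add_finrank_orthogonal (ℝ ∙ S.ξ x)
    have hξ0 : S.ξ x ≠ 0 := fun h => by simpa [h] using hS.η_ξ x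
    rw [finrank_span_singleton hξ0] at h1
    have h3 : Module.finrank ℝ (TangentSpace 𝓘(ℝ, E) x) = Module.finrank ℝ E := rfl
    have h4 : 0 < Module.finrank ℝ ↥(ℝ ∙ S.ξ x)ᗮ := by omega
    have := Module.finrank_pos_iff.1 h4
    obtain ⟨w, hw⟩ := exists_ne (0 : ↥(ℝ ∙ S.ξ x)ᗮ)
    exact ⟨w, Submodule.mem_orthogonal_singleton_iff_inner_right.1 w.2, fun h => hw (Subtype.ext h)⟩
  have hξ := hS.toIsMetric.smoothAt_ξ x
  have hZ := smoothAt_extend v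
  set Z := extend E v with hZdef
  have hZx : Z x = v := extend_apply_self ..
  -- Compares curvatures of the plane spanned by `v` and `ξ`: the left side is `α²|v|²` by
  -- `curvature_ξ`, and on the right only `g(v,v)η(ξ)η(ξ)` survives.
  have h := hG3 x Z S.ξ Z S.ξ hZ hξ hZ hξ
  have h0 : S.φField S.ξ = 0 := funext fun y => hS.φ_ξ y
  have h1 : ∀ X Y W : Π x : M, TangentSpace 𝓘(ℝ, E) x,
      riemann X (0 : Π x : M, TangentSpace 𝓘(ℝ, E) x) Y W x = 0 := by
    intro X Y W
    have h2 : leviCivita E M (0 : Π x : M, TangentSpace 𝓘(ℝ, E) x) = 0 := CovariantDerivative.zero _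
    have h3 : leviCivita E M (fun _ => 0 : Π x : M, TangentSpace 𝓘(ℝ, E) x) = 0 := h2
    simp [riemann, curvature, h2, h3]
  have hφ : (inner ℝ (S.φ x v) v : ℝ) = 0 := by
    have := hS.φ_skew x v v
    rw [real_inner_comm (S.φ x v) v] at this
    linarith
  rw [h0, h1, riemann, hS.curvature_ξ hZ hξ, hZx, hS.φ_ξ, hS.η_ξ, hS.η_eq x v, hv,
    real_inner_comm (S.ξ x) v, hv] at h
  simp only [inner_add_left, inner_sub_left, real_inner_smul_left, hφ, hv, inner_zero_left] at h
  have hvv : (inner ℝ v v : ℝ) ≠ 0 := inner_self_ne_zero.2 hv0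
  apply mul_right_cancel₀ hvv
  linarith

theorem IsAlphaSasakian.mvfderiv_η (hS : S.IsAlphaSasakian (fun _ => 1)) (hX : SmoothAt X x)
    (hY : SmoothAt Y x) : d% (fun y => S.η y (Y y)) x (X x) =
      -inner ℝ (S.φ x (X x)) (Y x) + S.η x (leviCivita E M Y x (X x)) := by
  simp only [hS.η_eq]
  rw [mvfderiv_inner hX (hS.toIsMetric.smoothAt_ξ x) hY, hS.leviCivita_ξ]
  simp

theorem IsAlphaSasakian.smoothFnAt_η (hS : S.IsAlphaSasakian α) (hY : SmoothAt Y x) :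
    SmoothFnAt (E := E) (fun y => S.η y (Y y)) x := by
  simp only [hS.η_eq]
  exact (hS.toIsMetric.smoothAt_ξ x).inner_fun hY

/-- By vanishing torsion `2dη(X,Y) = (∇_X η)Y - (∇_Y η)X`, and `∇ξ = -φ` with `φ` skew makes both
terms equal to `g(X, φY)`. -/
theorem IsAlphaSasakian.dη_eq (hS : S.IsAlphaSasakian (fun _ => 1)) (hX : SmoothAt X x)
    (hY : SmoothAt Y x) : S.dη X Y x = inner ℝ (X x) (S.φ x (Y x)) := by
  rw [dη, hS.mvfderiv_η hX hY, hS.mvfderiv_η hY hX, mlieBracket_eq_leviCivita hX hY, map_sub,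
    hS.φ_skew x (X x), real_inner_comm (X x) (S.φ x (Y x))]
  ring

/-- With brackets expressed through `∇`, the derivatives of `X` and `Y` cancel in the Nijenhuis
torsion. Only the algebraic terms of `∇φ` remain, and they add up to `-2g(X, φY)ξ`. -/
theorem IsAlphaSasakian.isSasakian (hS : S.IsAlphaSasakian (fun _ => 1)) : S.IsSasakian where
  toIsMetric := hS.toIsMetric
  contact _ _ _ hX hY := hS.dη_eq hX hY
  normal x X Y hX hY := by
    have hφX : SmoothAt (fun y => S.φ y (X y)) x := hS.toIsMetric.smoothAt_φ hX
    have hφY : SmoothAt (fun y => S.φ y (Y y)) x := hS.toIsMetric.smoothAt_φ hY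
    have h1 : (inner ℝ (S.φ x (X x)) (Y x) : ℝ) = -inner ℝ (X x) (S.φ x (Y x)) := hS.φ_skew ..
    rw [hS.dη_eq hX hY, nijenhuis, mlieBracket_eq_leviCivita hX hY,
      mlieBracket_eq_leviCivita hφX hφY, mlieBracket_eq_leviCivita hφX hY,
      mlieBracket_eq_leviCivita hX hφY]
    simp only [hS.leviCivita_φ _ _ _ hX, hS.leviCivita_φ _ _ _ hY, map_sub, map_add, map_smul,
      hS.φ_ξ, h1, real_inner_comm (X x) (S.φ x (Y x)), real_inner_comm (X x) (Y x)]
    module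

/-- The commutator of the curvature with `φ` on a Sasakian manifold. -/
theorem IsAlphaSasakian.curvature_φ (hS : S.IsAlphaSasakian (fun _ => 1)) (hX : SmoothAt X x)
    (hY : SmoothAt Y x) (hZ : SmoothAt Z x) :
    curvature X Y (S.φField Z) x = S.φ x (curvature X Y Z x)
      + ((inner ℝ (X x) (Z x) : ℝ) • S.φ x (Y x) - (inner ℝ (Y x) (Z x) : ℝ) • S.φ x (X x)
        + (inner ℝ (S.φ x (X x)) (Z x) : ℝ) • Y x - (inner ℝ (S.φ x (Y x)) (Z x) : ℝ) • X x) := by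
  have hξ := hS.toIsMetric.smoothAt_ξ x
  -- The second covariant derivative of `φZ`, from two uses of the formula for `∇φ`.
  -- Antisymmetrizing in `X`, `Y` cancels all derivatives of `X`, `Y`, `Z` outside `φ(R(X,Y)Z)`.
  have aux : ∀ {X Y : Π x : M, TangentSpace 𝓘(ℝ, E) x}, SmoothAt X x → SmoothAt Y x →
      leviCivita E M (fun y => leviCivita E M (S.φField Z) y (Y y)) x (X x) =
        S.φ x (leviCivita E M (fun y => leviCivita E M Z y (Y y)) x (X x))
        + ((inner ℝ (X x) (leviCivita E M Z x (Y x)) : ℝ) • S.ξ x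
          - S.η x (leviCivita E M Z x (Y x)) • X x)
        + ((inner ℝ (leviCivita E M Y x (X x)) (Z x) + inner ℝ (Y x) (leviCivita E M Z x (X x)) : ℝ)
            • S.ξ x - (inner ℝ (Y x) (Z x) : ℝ) • S.φ x (X x))
        - ((-inner ℝ (S.φ x (X x)) (Z x) + S.η x (leviCivita E M Z x (X x))) • Y x
          + S.η x (Z x) • leviCivita E M Y x (X x)) := by
    intro X Y hX hY
    have h1 := hZ.leviCivita hY
    have h2 : SmoothAt (fun y => S.φ y (leviCivita E M Z y (Y y))) x := hS.toIsMetric.smoothAt_φ h1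
    have h3 := SmoothAt.smul (hY.inner_fun hZ) hξ
    have h4 := SmoothAt.smul (hS.smoothFnAt_η hZ) hY
    have h5 : ∀ᶠ y in 𝓝 x, leviCivita E M (S.φField Z) y (Y y) =
        S.φ y (leviCivita E M Z y (Y y)) + (inner ℝ (Y y) (Z y) : ℝ) • S.ξ y
          - S.η y (Z y) • Y y := by
      filter_upwards [hZ.eventually] with y hy
      change leviCivita E M (fun y => S.φ y (Z y)) y (Y y) = _
      rw [hS.leviCivita_φ _ _ _ hy, one_smul, add_sub_assoc]
    rw [leviCivita_congr ((h2.add h3).sub h4) h5, leviCivita_sub (h2.add h3) h4,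
      leviCivita_add h2 h3, sub_apply, add_apply, hS.leviCivita_φ _ _ _ h1,
      leviCivita_smul (hY.inner_fun hZ) hξ, leviCivita_smul (hS.smoothFnAt_η hZ) hY,
      mvfderiv_inner hX hY hZ, hS.mvfderiv_η hX hZ, hS.leviCivita_ξ]
    module
  have h6 : ∀ v, leviCivita E M (S.φField Z) x v = S.φ x (leviCivita E M Z x v)
      + ((inner ℝ v (Z x) : ℝ) • S.ξ x - S.η x (Z x) • v) := fun v => by
    change leviCivita E M (fun y => S.φ y (Z y)) x v = _
    rw [hS.leviCivita_φ _ _ _ hZ, one_smul]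
  simp only [curvature]
  rw [aux hX hY, aux hY hX, h6]
  simp only [mlieBracket_eq_leviCivita hX hY, map_sub, inner_sub_left, smul_sub]
  module

/-- Pair symmetry turns the first term into `g(R(Y,X)φZ, φW)`. Commuting `φ` past the curvature and
using `g(φU, φW) = g(U,W) - η(U)η(W)` leaves only `η(R(Y,X)Z)`, which is known from `curvature_ξ`.
-/
theorem IsAlphaSasakian.g1 (hS : S.IsAlphaSasakian (fun _ => 1)) : S.G1 := by
  intro x X Y Z W hX hY hZ hW
  have hφZ := hS.toIsMetric.smoothAt_φ hZ
  have hφW := hS.toIsMetric.smoothAt_φ hW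
  have hξ := hS.toIsMetric.smoothAt_ξ x
  have h1 : (inner ℝ (S.ξ x) (curvature Y X Z x) : ℝ) =
      -(S.η x (X x) * inner ℝ (Y x) (Z x) - S.η x (Y x) * inner ℝ (X x) (Z x)) := by
    rw [real_inner_comm, inner_curvature_swap hY hX hZ hξ, hS.curvature_ξ hY hX, mvfderiv_const]
    simp [inner_sub_left, real_inner_smul_left]
  rw [riemann, riemann, inner_curvature_pair_symm hφZ hφW hY hX,
    inner_curvature_pair_symm hZ hW hY hX, hS.curvature_φ hY hX hZ]
  change (inner ℝ _ (S.φ x (W x)) : ℝ) - _ = _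
  simp only [inner_add_left, inner_sub_left, real_inner_smul_left, hS.inner_φ_φ]
  rw [hS.η_eq x (curvature Y X Z x), h1, hS.φ_skew x (Y x), hS.φ_skew x (X x)]
  ring

/-- By skewness of `φ`, the terms with `φX` and with `φY` together form the commutator of `R(Z, φW)`
with `φ` applied to `Y` and paired with `X`. It is algebraic by `curvature_φ`, and (G1) handles the
remaining difference of curvatures. -/
theorem IsAlphaSasakian.g2 (hS : S.IsAlphaSasakian (fun _ => 1)) : S.G2 := by
  intro x X Y Z W hX hY hZ hW
  have h1 := hS.g1 x X Y Z W hX hY hZ hW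
  have hφW := hS.toIsMetric.smoothAt_φ hW
  have h2 : riemann (S.φField X) Y Z (S.φField W) x =
      -inner ℝ (S.φ x (curvature Z (S.φField W) Y x)) (X x) := by
    rw [hS.φ_skew, neg_neg]
    rfl
  have h4 : S.φField W x = S.φ x (W x) := rfl
  have c := fun u v : TangentSpace 𝓘(ℝ, E) x => real_inner_comm v u
  rw [riemann, riemann] at h1
  rw [h2, riemann, riemann, riemann, hS.curvature_φ hZ hφW hY, h4]
  simp only [inner_add_left, inner_sub_left, real_inner_smul_left, hS.φ_sq, inner_neg_left,
    ← hS.η_eq]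
  rw [c (S.φ x (W x)) (Y x), c (S.φ x (W x)) (X x), c (S.φ x (Z x)) (Y x), c (S.φ x (Z x)) (X x),
    c (Z x) (Y x), c (Z x) (X x), c (W x) (X x), c (W x) (Y x)]
  linear_combination -h1

end AlmostContact

/-! ### Change of the unit normal by a smooth sign -/

section Rescale

variable {E : Type*} [NormedAddCommGroup E] [NormedSpace ℝ E] [FiniteDimensional ℝ E]
  {M : Type*} [TopologicalSpace M] [ChartedSpace E M] [IsManifold 𝓘(ℝ, E) ∞ M]
  [RiemannianBundle (fun x : M => TangentSpace 𝓘(ℝ, E) x)]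
  [IsContMDiffRiemannianBundle 𝓘(ℝ, E) ∞ E (fun x : M => TangentSpace 𝓘(ℝ, E) x)]
  {E' : Type*} [NormedAddCommGroup E'] [NormedSpace ℝ E'] [FiniteDimensional ℝ E']
  {M' : Type*} [TopologicalSpace M'] [ChartedSpace E' M'] [IsManifold 𝓘(ℝ, E') ∞ M']
  [RiemannianBundle (fun x : M' => TangentSpace 𝓘(ℝ, E') x)]
  [IsContMDiffRiemannianBundle 𝓘(ℝ, E') ∞ E' (fun x : M' => TangentSpace 𝓘(ℝ, E') x)]
  {J : Π x : M', TangentSpace 𝓘(ℝ, E') x →L[ℝ] TangentSpace 𝓘(ℝ, E') x}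
  {f : M → M'} {N : Π x : M, TangentSpace 𝓘(ℝ, E') (f x)} {β ε : M → ℝ}

/-- Changing the unit normal by a smooth sign. -/
theorem IsUnitNormal.smul (hN : IsUnitNormal E f N) (hε : ContMDiff 𝓘(ℝ, E) 𝓘(ℝ) ∞ ε)
    (hε1 : ∀ x, ε x ^ 2 = 1) : IsUnitNormal E f (fun x => ε x • N x) where
  smooth := hN.smooth
  isometry := hN.isometry
  smooth_normal x := by
    have h := (contMDiffAt_totalSpace.1 (hN.smooth_normal x)).2
    refine contMDiffAt_totalSpace.2 ⟨hN.smooth x, ((hε x).smul h).congr_of_eventuallyEq ?_⟩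
    exact coord_smul_eventuallyEq ε (hN.smooth x).continuousAt
  unit x := by
    rw [norm_smul, hN.unit, mul_one, Real.norm_eq_abs]
    rw [← Real.sqrt_one, ← hε1 x, Real.sqrt_sq_eq_abs]
  normal x u := by rw [real_inner_smul_left, hN.normal, mul_zero]

/-- The derivative of `ε` only contributes a multiple of `N`, which the tangential projection
removes; `ε` need not be known to be locally constant. -/
theorem IsTotallyUmbilical.smul (hβ : IsTotallyUmbilical E f N β) (hN : IsUnitNormal E f N)
    (hε : ContMDiff 𝓘(ℝ, E) 𝓘(ℝ) ∞ ε) :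
    IsTotallyUmbilical E f (fun x => ε x • N x) (fun x => ε x * β x) := by
  refine ⟨hε.mul hβ.1, fun x v => ?_⟩
  have h1 := hβ.2 x v
  have h2 : tangential E f x (covAlong E f N x v) = -(β x • v) := by
    rw [← h1]
    simp [weingarten]
  have h3 : weingarten E f (fun x => ε x • N x) x v =
    -tangential E f x (covAlong E f (fun x => ε x • N x) x v) := rfl
  rw [h3, covAlong_smul ((hε x).mdifferentiableAt (by simp)) (hN.mdiffAlong x), map_add, map_smul,
    map_smul, hN.tangential_normal, h2]
  module

theorem induced_smul_η (J : Π x : M', TangentSpace 𝓘(ℝ, E') x →L[ℝ] TangentSpace 𝓘(ℝ, E') x)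
    (f : M → M') (N : Π x : M, TangentSpace 𝓘(ℝ, E') (f x)) (ε : M → ℝ) (x : M)
    (v : TangentSpace 𝓘(ℝ, E) x) :
    (inducedAlmostContact E J f (fun x => ε x • N x)).η x v =
      ε x * (inducedAlmostContact E J f N).η x v := by
  simp [inducedAlmostContact]

/-- The tensor `φ` does not involve the normal, and `η`, which scales by `ε`, occurs in products of
two, so only `ε² = 1` enters. -/
theorem AlmostContact.g2_of_induced_smul (hε1 : ∀ x, ε x ^ 2 = 1)
    (h : (inducedAlmostContact E J f (fun x => ε x • N x)).G2) :
    (inducedAlmostContact E J f N).G2 := by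
  intro x X Y Z W hX hY hZ hW
  have h1 := h x X Y Z W hX hY hZ hW
  simp only [induced_smul_η] at h1
  refine h1.trans ?_
  change riemann ((inducedAlmostContact E J f N).φField X) Y Z
      ((inducedAlmostContact E J f N).φField W) x
    + riemann X ((inducedAlmostContact E J f N).φField Y) Z
      ((inducedAlmostContact E J f N).φField W) x
    + riemann X Y ((inducedAlmostContact E J f N).φField Z)
      ((inducedAlmostContact E J f N).φField W) x + _ - _ = _
  linear_combination ((inner ℝ (X x) (Z x) : ℝ) * (inducedAlmostContact E J f N).η x (W x) *
    (inducedAlmostContact E J f N).η x (Y x) - inner ℝ (Z x) (Y x) *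
    (inducedAlmostContact E J f N).η x (X x) * (inducedAlmostContact E J f N).η x (W x)) * hε1 x

theorem isLocallyConstant_of_sq_eq_one {β : M → ℝ} (hβ : Continuous β) (h : ∀ x, β x ^ 2 = 1) :
    IsLocallyConstant β := by
  rw [IsLocallyConstant.iff_eventually_eq]
  intro x
  -- The values `1` and `-1` are at distance 2, so radius 1 excludes a change of sign.
  filter_upwards [hβ.continuousAt.eventually (Metric.ball_mem_nhds (β x) one_pos)] with y hy
  rw [Real.dist_eq, abs_lt] at hy
  rcases sq_eq_sq_iff_eq_or_eq_neg.1 ((h y).trans (h x).symm) with h1 | h1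
  · exact h1
  · rw [h1] at hy
    nlinarith [h x, hy.1, hy.2]

end Rescale

end RiemannianGeometry
end

theorem mainTheorem8 (n : ℕ) (hn : 1 ≤ n)
    -- the ambient Kähler manifold `M'`, of real dimension `2n + 2`
    {M' : Type*} [TopologicalSpace M'] [T2Space M'] [SecondCountableTopology M']
    [ChartedSpace (EuclideanSpace ℝ (Fin (2 * n + 2))) M']
    [IsManifold 𝓘(ℝ, EuclideanSpace ℝ (Fin (2 * n + 2))) ∞ M']
    [RiemannianBundle
      (fun p : M' => TangentSpace 𝓘(ℝ, EuclideanSpace ℝ (Fin (2 * n + 2))) p)]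
    [IsContMDiffRiemannianBundle 𝓘(ℝ, EuclideanSpace ℝ (Fin (2 * n + 2))) ∞
      (EuclideanSpace ℝ (Fin (2 * n + 2)))
      (fun p : M' => TangentSpace 𝓘(ℝ, EuclideanSpace ℝ (Fin (2 * n + 2))) p)]
    (J : Π p : M', TangentSpace 𝓘(ℝ, EuclideanSpace ℝ (Fin (2 * n + 2))) p →L[ℝ]
      TangentSpace 𝓘(ℝ, EuclideanSpace ℝ (Fin (2 * n + 2))) p)
    (hJ : RiemannianGeometry.IsKaehler J)
    -- the hypersurface `M`, of dimension `2n + 1`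
    {M : Type*} [TopologicalSpace M] [T2Space M] [SecondCountableTopology M]
    [ChartedSpace (EuclideanSpace ℝ (Fin (2 * n + 1))) M]
    [IsManifold 𝓘(ℝ, EuclideanSpace ℝ (Fin (2 * n + 1))) ∞ M]
    [RiemannianBundle
      (fun x : M => TangentSpace 𝓘(ℝ, EuclideanSpace ℝ (Fin (2 * n + 1))) x)]
    [IsContMDiffRiemannianBundle 𝓘(ℝ, EuclideanSpace ℝ (Fin (2 * n + 1))) ∞
      (EuclideanSpace ℝ (Fin (2 * n + 1)))
      (fun x : M => TangentSpace 𝓘(ℝ, EuclideanSpace ℝ (Fin (2 * n + 1))) x)]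
    (f : M → M')
    (N : Π x : M, TangentSpace 𝓘(ℝ, EuclideanSpace ℝ (Fin (2 * n + 2))) (f x))
    (hN : RiemannianGeometry.IsUnitNormal (EuclideanSpace ℝ (Fin (2 * n + 1))) f N)
    (β : M → ℝ) (hβ : RiemannianGeometry.IsTotallyUmbilical (EuclideanSpace ℝ (Fin (2 * n + 1))) f N β)
    (hG3 : (RiemannianGeometry.inducedAlmostContact (EuclideanSpace ℝ (Fin (2 * n + 1))) J f N).G3) :
    (∀ x, β x = 1 ∨ β x = -1) ∧ IsLocallyConstant β ∧
    (RiemannianGeometry.inducedAlmostContact (EuclideanSpace ℝ (Fin (2 * n + 1))) J f (fun x => -β x • N x)).IsSasakian ∧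
    (RiemannianGeometry.inducedAlmostContact (EuclideanSpace ℝ (Fin (2 * n + 1))) J f N).G1 ∧
    (RiemannianGeometry.inducedAlmostContact (EuclideanSpace ℝ (Fin (2 * n + 1))) J f N).G2 ∧
    (RiemannianGeometry.inducedAlmostContact (EuclideanSpace ℝ (Fin (2 * n + 1))) J f N).G3 := by

  have hdim : Module.finrank ℝ (EuclideanSpace ℝ (Fin (2 * n + 2)))
      = Module.finrank ℝ (EuclideanSpace ℝ (Fin (2 * n + 1))) + 1 := by simp
  have hα := RiemannianGeometry.inducedAlmostContact_isAlphaSasakian hJ hN hβ hdim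
  -- The hypothesis `1 ≤ n` enters here: `2n + 1 > 1` provides a nonzero vector orthogonal to `ξ`.
  have hsq : ∀ x, (-β x) ^ 2 = 1 := hα.sq_eq_one hG3 (by simp; omega)
  have hsq' : ∀ x, β x ^ 2 = 1 := fun x => by rw [← hsq x, neg_sq]
  -- The sign is `ε = -β`, smooth because `β` is; the new umbilicity factor `-β · β` is `-1`, whence
  -- `α = 1`.
  have hN' := hN.smul hβ.1.neg hsq
  have hβ' := hβ.smul hN hβ.1.neg
  have hα' := RiemannianGeometry.inducedAlmostContact_isAlphaSasakian hJ hN' hβ' hdim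
  have hone : (fun x => -(-β x * β x)) = fun _ => 1 := by
    funext x
    linear_combination hsq' x
  rw [hone] at hα'
  -- (G1) contains no `η`, so for the normals `N` and `-βN` it is definitionally the same statement
  -- and needs no transfer.
  exact ⟨fun x => sq_eq_sq_iff_eq_or_eq_neg.1 ((hsq' x).trans (one_pow 2).symm),
    RiemannianGeometry.isLocallyConstant_of_sq_eq_one hβ.1.continuous hsq',
    hα'.isSasakian, hα'.g1, RiemannianGeometry.AlmostContact.g2_of_induced_smul hsq hα'.g2, hG3⟩
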